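/- Work in $\mathbb R^3\times\mathbb R=\mathbb R^4$ with units in which the speed of light is $1$. Let $F\subset\mathbb R^3$ be compact, $t_0\in\mathbb R$, and let $r_2:\mathbb R\times F\to\mathbb R^3$ be a *flow of matter*: $r_2$ is infinitely differentiable in $t$; $r_2$ and all its $t$-derivatives are continuous on $\mathbb R\times F$; for every $t_1$ there is $v_1<1$ with $|\partial_t r_2(t,r_0)|\le v_1$ for all $t\le t_1$, $r_0\in F$; for every $t$ the map $r_0\mapsto r_2(t,r_0)$ is one-to-one; and $r_2(t_0,r_0)=r_0$. Let $q$ be a finite signed Borel measure on $F$. For $(r_1,t)\in\mathbb R^3\times\mathbb R$ and $r_0\in F$ let $T=T(r_1,t,r_0)$ be the unique solution of $T=|r_1-r_2(t-T,r_0)|$, put $\tau=t-T$, $v=(\partial_t r_2)(\tau,r_0)$, and, where $T>0$, $$u=\frac1T,\qquad e=\frac{r_1-r_2(\tau,r_0)}{T},\qquad z=\frac1{1-\langle e,v\rangle}.$$ For a function $h(r_1,t,r_0)$ that for each $r_0\in F$ is locally integrable in $(r_1,t)\in\mathbb R^4$ (it may be undefined on the null set $T=0$), $\int_F h\,dq$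 denotes the distribution $g\mapsto\int_F\big(\int_{\mathbb R^4}h(x,r_0)\,g(x)\,dx\big)\,q(dr_0)$ on $\mathbb R^4$ (componentwise for vector-valued $h$). Being well defined includes that the inner integral is $|q|$-integrable in $r_0$ for every test function $g$, and that the resulting functional is a distribution. **Theorem.** The potentials $$\phi=\int_F uz\,dq,\qquad A=\int_F uzv\,dq$$ are well-defined distributions on $\mathbb R^4$. With $\Box=\nabla^2-\partial_t^2$, put $S=-\Box\phi$ and $J=-\Box A$ (the generalized charge and current densities), $E=-\nabla\phi-\partial_tA$ and $B=\nabla\times A$, all derivatives being distributional. Then Maxwell's equations $$\nabla\cdot E=S,\qquad \nabla\times E=-\partial_tB,\qquad \nabla\cdot B=0,\qquad \nabla\times B=\partial_tE+J$$ hold in the sense of distributions, and so does the equation of continuity $\nabla\cdot J+\partial_tS=0$. Moreover, where $T>0$ the functions $u^2e$, $e$ and $\partial_te$ are differentiable in $t$, and, with the derivatives inside the integrals taken pointwise there, $$E=\int_F\Big(u^2e+u^{-1}\partial_t(u^2e)+\partial_t^2e\Big)\,dq,\qquad B=\int_F e\times\Big(u^2e+u^{-1}\partial_t(u^2e)+\partial_t^2e\Big)\,dq,$$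 where both integrals are well defined. -/

import Mathlib

open MeasureTheory Set TopologicalSpace
open scoped Distributions ContDiff LineDeriv

noncomputable section

namespace MatterFlow

/-- Euclidean three-dimensional space. -/
abbrev Space : Type := EuclideanSpace ℝ (Fin 3)

/-- Points `(r₁, t)` of `R³ × R = R⁴`, with four-dimensional Lebesgue measure as `volume`. -/
abbrev SpaceTime : Type := Space × ℝ

/-! ### Flows of matter and their fundamental fields -/

/-- `r₂ : R × F → R³` is a flow of matter whose positions at time `t₀` fill the compact set `F`:
it is infinitely differentiable in `t`, it and all its `t`-derivatives are jointly continuous, on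
every half-line `t ≤ t₁` the speeds are bounded by a constant smaller than the speed of light `1`,
for every `t` the map `r₀ ↦ r₂(t, r₀)` is one-to-one, and `r₂(t₀, r₀) = r₀`. -/
structure IsFlowOfMatter (F : Set Space) (t₀ : ℝ) (r₂ : ℝ → F → Space) : Prop where
  isCompact : IsCompact F
  contDiff : ∀ r₀ : F, ContDiff ℝ ∞ fun t => r₂ t r₀
  continuous_iteratedDeriv : ∀ n : ℕ,
    Continuous fun p : ℝ × F => iteratedDeriv n (fun t => r₂ t p.2) p.1
  speed_le : ∀ t₁ : ℝ, ∃ v₁ : ℝ, v₁ < 1 ∧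
    ∀ t ≤ t₁, ∀ r₀ : F, ‖deriv (fun s => r₂ s r₀) t‖ ≤ v₁
  injective : ∀ t : ℝ, Function.Injective (r₂ t)
  initial : ∀ r₀ : F, r₂ t₀ r₀ = r₀

variable {F : Set Space}

/-- The time delay `T(r₁, t, r₀)`: the solution `T` of `T = |r₁ - r₂(t - T, r₀)|`.
For a flow of matter it exists and is unique, see `IsFlowOfMatter.existsUnique_timeDelay`. -/
def timeDelay (r₂ : ℝ → F → Space) (r₀ : F) (x : SpaceTime) : ℝ :=
  Classical.epsilon fun T : ℝ => T = ‖x.1 - r₂ (x.2 - T) r₀‖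

theorem IsFlowOfMatter.existsUnique_timeDelay {t₀ : ℝ} {r₂ : ℝ → F → Space}
    (h : IsFlowOfMatter F t₀ r₂) (r₀ : F) (x : SpaceTime) :
    ∃! T : ℝ, T = ‖x.1 - r₂ (x.2 - T) r₀‖ := by
  obtain ⟨v, hv1, hv⟩ := h.speed_le x.2
  have hv0 : 0 ≤ v := (norm_nonneg _).trans (hv x.2 le_rfl r₀)
  have hd : Differentiable ℝ fun t => r₂ t r₀ := (h.contDiff r₀).differentiable (by simp)
  have hlip : ∀ s ≤ x.2, ∀ s' ≤ x.2, ‖r₂ s r₀ - r₂ s' r₀‖ ≤ v * ‖s - s'‖ := by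
    intro s hs s' hs'
    exact (convex_Iic x.2).norm_image_sub_le_of_norm_deriv_le (f := fun t => r₂ t r₀)
      (fun y _ => hd y) (fun y hy => hv y hy r₀) hs' hs
  have hK : ContractingWith (⟨v, hv0⟩ : NNReal)
      (fun T : ℝ => ‖x.1 - r₂ (x.2 - max T 0) r₀‖) := by
    refine ⟨by exact_mod_cast hv1, LipschitzWith.of_dist_le_mul fun a b => ?_⟩
    have h1 := hlip (x.2 - max b 0) (by simp) (x.2 - max a 0) (by simp)
    have h2 : |(x.2 - max b 0) - (x.2 - max a 0)| ≤ |a - b| := by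
      have := abs_max_sub_max_le_abs a b 0
      rwa [show (x.2 - max b 0) - (x.2 - max a 0) = max a 0 - max b 0 by ring]
    rw [Real.norm_eq_abs] at h1
    rw [Real.dist_eq, Real.dist_eq]
    calc _ ≤ ‖(x.1 - r₂ (x.2 - max a 0) r₀) - (x.1 - r₂ (x.2 - max b 0) r₀)‖ :=
          abs_norm_sub_norm_le _ _
      _ = ‖r₂ (x.2 - max b 0) r₀ - r₂ (x.2 - max a 0) r₀‖ := by congr 1; abel
      _ ≤ v * |a - b| := h1.trans (mul_le_mul_of_nonneg_left h2 hv0)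
  have hfix := hK.fixedPoint_isFixedPt
  refine ⟨hK.fixedPoint, ?_, fun T hT => ?_⟩
  · have h0 : 0 ≤ hK.fixedPoint := by
      rw [← hfix.eq]; exact norm_nonneg _
    have h1 := hfix.eq
    simp only [max_eq_left h0] at h1
    exact h1.symm
  · have hT' : T = ‖x.1 - r₂ (x.2 - T) r₀‖ := hT
    have h0 : 0 ≤ T := by rw [hT']; exact norm_nonneg _
    refine hK.fixedPoint_unique ?_
    change ‖x.1 - r₂ (x.2 - max T 0) r₀‖ = T
    rw [max_eq_left h0]
    exact hT'.symm

theorem IsFlowOfMatter.timeDelay_eq {t₀ : ℝ} {r₂ : ℝ → F → Space}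
    (h : IsFlowOfMatter F t₀ r₂) (r₀ : F) (x : SpaceTime) :
    timeDelay r₂ r₀ x = ‖x.1 - r₂ (x.2 - timeDelay r₂ r₀ x) r₀‖ :=
  Classical.epsilon_spec (p := fun T : ℝ => T = ‖x.1 - r₂ (x.2 - T) r₀‖)
    (h.existsUnique_timeDelay r₀ x).exists

/-- Retarded time `τ = t - T`. -/
def retardedTime (r₂ : ℝ → F → Space) (r₀ : F) (x : SpaceTime) : ℝ :=
  x.2 - timeDelay r₂ r₀ x

/-- Retarded velocity `v = v₂(τ, r₀)`, where `v₂ = ∂r₂/∂t`. -/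
def retardedVelocity (r₂ : ℝ → F → Space) (r₀ : F) (x : SpaceTime) : Space :=
  deriv (fun s => r₂ s r₀) (retardedTime r₂ r₀ x)

/-- The field `u = 1 / T` (meaningful where `T > 0`). -/
def uField (r₂ : ℝ → F → Space) (r₀ : F) (x : SpaceTime) : ℝ :=
  1 / timeDelay r₂ r₀ x

/-- The unit vector field `e = r₁₂ / T`, `r₁₂ = r₁ - r₂(τ, r₀)` (meaningful where `T > 0`). -/
def eField (r₂ : ℝ → F → Space) (r₀ : F) (x : SpaceTime) : Space :=
  (1 / timeDelay r₂ r₀ x) • (x.1 - r₂ (retardedTime r₂ r₀ x) r₀)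

/-- The field `z = 1 / (1 - ⟨e, v⟩)` (meaningful where `T > 0`). -/
def zField (r₂ : ℝ → F → Space) (r₀ : F) (x : SpaceTime) : ℝ :=
  1 / (1 - inner ℝ (eField r₂ r₀ x) (retardedVelocity r₂ r₀ x))

/-- Pointwise partial derivative with respect to time of a function of `(r₁, t)`. -/
def timeDeriv (f : SpaceTime → Space) (x : SpaceTime) : Space :=
  deriv (fun s => f (x.1, s)) x.2

/-- The vector field `u² e`. -/
def uSqE (r₂ : ℝ → F → Space) (r₀ : F) (x : SpaceTime) : Space :=
  uField r₂ r₀ x ^ 2 • eField r₂ r₀ x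

/-- The vector field `u² e + u⁻¹ ∂ₜ(u² e) + ∂ₜ² e` (meaningful where `T > 0`). -/
def feynmanField (r₂ : ℝ → F → Space) (r₀ : F) (x : SpaceTime) : Space :=
  uSqE r₂ r₀ x + (uField r₂ r₀ x)⁻¹ • timeDeriv (uSqE r₂ r₀) x
    + timeDeriv (timeDeriv (eField r₂ r₀)) x

/-- The cross product in Euclidean space. -/
def cross (a b : Space) : Space := WithLp.toLp 2 (crossProduct a.ofLp b.ofLp)

/-! ### Generalized functions on `R⁴` -/

/-- Generalized scalar functions on `R⁴`. -/
abbrev ScalarDistribution : Type := 𝓓'((⊤ : Opens SpaceTime), ℝ)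

/-- Generalized vector functions on `R⁴`, identified with triples of generalized scalar
functions. -/
abbrev VectorDistribution : Type := Fin 3 → ScalarDistribution

/-- The distributional partial derivative `Dᵢ` in the `i`-th space direction. -/
def dSpace (i : Fin 3) (f : ScalarDistribution) : ScalarDistribution :=
  ∂_{((EuclideanSpace.single i 1, 0) : SpaceTime)} f

/-- The distributional partial derivative `D = ∂/∂t`. -/
def dTime (f : ScalarDistribution) : ScalarDistribution :=
  ∂_{((0, 1) : SpaceTime)} f

/-- `∂/∂t` of a vector distribution. -/
def dTimeVec (A : VectorDistribution) : VectorDistribution := fun i => dTime (A i)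

/-- `∇f`. -/
def grad (f : ScalarDistribution) : VectorDistribution := fun i => dSpace i f

/-- `∇ · A`. -/
def divergence (A : VectorDistribution) : ScalarDistribution :=
  dSpace 0 (A 0) + dSpace 1 (A 1) + dSpace 2 (A 2)

/-- `∇ × A`. -/
def curl (A : VectorDistribution) : VectorDistribution :=
  ![dSpace 1 (A 2) - dSpace 2 (A 1),
    dSpace 2 (A 0) - dSpace 0 (A 2),
    dSpace 0 (A 1) - dSpace 1 (A 0)]

/-- The d'Alembertian `□² = ∇² - ∂²/∂t²`. -/
def box (f : ScalarDistribution) : ScalarDistribution :=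
  divergence (grad f) - dTime (dTime f)

/-- The d'Alembertian of a vector distribution, taken componentwise. -/
def boxVec (A : VectorDistribution) : VectorDistribution := fun i => box (A i)

/-! ### Integrals of generalized functions against a charge -/

/-- `H = ∫_F f(·, r₀) q(dr₀)` as a generalized function: every function `f(·, r₀)` is locally
integrable on `R⁴`, hence is a distribution `g ↦ ∫ g f(·, r₀)`, and for every test function `g` the
number `⟨H, g⟩` is the (absolutely convergent) integral of `r₀ ↦ ⟨f(·, r₀), g⟩` against the signed
measure `q`. -/
def IsChargeIntegral (q : SignedMeasure F) (f : F → SpaceTime → ℝ) (H : ScalarDistribution) :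
    Prop :=
  (∀ r₀ : F, LocallyIntegrable (f r₀)) ∧
  ∀ g : 𝓓((⊤ : Opens SpaceTime), ℝ),
    q.Integrable (fun r₀ => ∫ x, g x * f r₀ x) ∧
    H g = ∫ᵛ r₀, (∫ x, g x * f r₀ x) ∂•q

/-- The same notion for vector fields, componentwise. -/
def IsChargeIntegralVec (q : SignedMeasure F) (f : F → SpaceTime → Space)
    (H : VectorDistribution) : Prop :=
  ∀ i : Fin 3, IsChargeIntegral q (fun r₀ x => f r₀ x i) (H i)

theorem IsChargeIntegral.unique {q : SignedMeasure F} {f : F → SpaceTime → ℝ}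
    {H H' : ScalarDistribution} (h : IsChargeIntegral q f H) (h' : IsChargeIntegral q f H') :
    H = H' := by
  ext g
  rw [(h.2 g).2, (h'.2 g).2]

/-- `φ = ∫_F u z dq`. -/
def IsScalarPotential (r₂ : ℝ → F → Space) (q : SignedMeasure F) (φ : ScalarDistribution) : Prop :=
  IsChargeIntegral q (fun r₀ x => uField r₂ r₀ x * zField r₂ r₀ x) φ

/-- `A = ∫_F u z v dq`. -/
def IsVectorPotential (r₂ : ℝ → F → Space) (q : SignedMeasure F) (A : VectorDistribution) : Prop :=
  IsChargeIntegralVec q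
    (fun r₀ x => (uField r₂ r₀ x * zField r₂ r₀ x) • retardedVelocity r₂ r₀ x) A

end MatterFlow

end

open MatterFlow

/-!
The potentials satisfy the Lorenz gauge condition, which together with the definitions of `S`, `J`,
`E` and `B` gives Maxwell's equations and the equation of continuity formally.

All distributional derivatives are computed under the integral over `F`. For a fixed charge `r₀` the
set `T = 0` is its world line, along which `u` blows up like the inverse distance in `ℝ³`: since
speeds stay away from `1`, `T` is at least half the distance of `r₁` to the simultaneous position
`r₂(t, r₀)`. So `u ^ 2` is still locally integrable, and the pointwise derivatives of `u z` and
`u z v` are `O(u ^ 2)`. They are the distributional derivatives too: cutting off the region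
`T < 1 / n` costs a term that tends to `0` by dominated convergence. It remains to differentiate
`T = |r₁ - r₂(t - T, r₀)|` where `T > 0` and to check pointwise identities.
-/

noncomputable section

open MeasureTheory Set TopologicalSpace Filter Topology Asymptotics Module
open scoped Distributions ContDiff LineDeriv ENNReal NNReal

namespace MatterFlow

/-! ### Distributional derivatives and Maxwell's equations -/

section LineDerivative

variable {E V : Type*} [NormedAddCommGroup E] [NormedSpace ℝ E] {Ω : Opens E}

theorem testFunction_lineDerivOp_apply [NormedAddCommGroup V] [NormedSpace ℝ V] (v : E)
    (g : 𝓓(Ω, V)) (x : E) : (∂_{v} g) x = fderiv ℝ g x v := by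
  have hg : Differentiable ℝ g := g.contDiff.differentiable (by simp)
  rw [TestFunction.lineDerivOp_eq_lineDerivCLM ℝ, TestFunction.lineDerivCLM_apply_of_le (by simp),
    (hg x).lineDeriv_eq_fderiv]

theorem testFunction_lineDerivOp_comm [NormedAddCommGroup V] [NormedSpace ℝ V] (v w : E)
    (g : 𝓓(Ω, V)) : ∂_{v} (∂_{w} g) = ∂_{w} (∂_{v} g) := by
  have hg : ContDiff ℝ ∞ g := g.contDiff
  have hg' : Differentiable ℝ (fderiv ℝ g) :=
    (hg.fderiv_right (m := ∞) (by simp)).differentiable (by simp)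
  have second_deriv (v w x : E) : (∂_{v} (∂_{w} g)) x = fderiv ℝ (fderiv ℝ g) x v w := by
    have hw : ⇑(∂_{w} g : 𝓓(Ω, V)) = fun y => fderiv ℝ g y w :=
      funext (testFunction_lineDerivOp_apply w g)
    rw [testFunction_lineDerivOp_apply, hw, fderiv_clm_apply (hg' x) (by fun_prop)]
    simp
  ext x
  rw [second_deriv, second_deriv]
  exact hg.contDiffAt.isSymmSndFDerivAt
    (by simpa using WithTop.coe_le_coe.2 (le_top (a := (2 : ℕ∞)))) v w

theorem distribution_lineDerivOp_comm [AddCommGroup V] [Module ℝ V] [TopologicalSpace V]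
    [IsTopologicalAddGroup V] [ContinuousSMul ℝ V] (v w : E) (H : 𝓓'(Ω, V)) :
    ∂_{v} (∂_{w} H) = ∂_{w} (∂_{v} H) := by
  ext g
  simp only [Distribution.lineDerivOp_apply_apply, LineDeriv.lineDerivOp_neg, neg_neg]
  rw [testFunction_lineDerivOp_comm]

end LineDerivative

section Maxwell

theorem dSpace_add (i : Fin 3) (f g : ScalarDistribution) :
    dSpace i (f + g) = dSpace i f + dSpace i g := LineDeriv.lineDerivOp_add _ _ _

theorem dSpace_neg (i : Fin 3) (f : ScalarDistribution) : dSpace i (-f) = -dSpace i f :=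
  LineDeriv.lineDerivOp_neg _ _

theorem dSpace_sub (i : Fin 3) (f g : ScalarDistribution) :
    dSpace i (f - g) = dSpace i f - dSpace i g := by
  rw [sub_eq_add_neg, dSpace_add, dSpace_neg, ← sub_eq_add_neg]

theorem dTime_add (f g : ScalarDistribution) : dTime (f + g) = dTime f + dTime g :=
  LineDeriv.lineDerivOp_add _ _ _

theorem dTime_neg (f : ScalarDistribution) : dTime (-f) = -dTime f :=
  LineDeriv.lineDerivOp_neg _ _

theorem dTime_sub (f g : ScalarDistribution) : dTime (f - g) = dTime f - dTime g := by
  rw [sub_eq_add_neg, dTime_add, dTime_neg, ← sub_eq_add_neg]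

theorem dSpace_comm (i j : Fin 3) (f : ScalarDistribution) :
    dSpace i (dSpace j f) = dSpace j (dSpace i f) := distribution_lineDerivOp_comm _ _ _

theorem dTime_dSpace (i : Fin 3) (f : ScalarDistribution) :
    dTime (dSpace i f) = dSpace i (dTime f) := distribution_lineDerivOp_comm _ _ _

theorem box_add (f g : ScalarDistribution) : box (f + g) = box f + box g := by
  simp only [box, divergence, grad, dSpace_add, dTime_add]
  abel

theorem box_dSpace (i : Fin 3) (f : ScalarDistribution) : box (dSpace i f) = dSpace i (box f) := by
  simp only [box, divergence, grad, dSpace_sub, dSpace_add, dTime_dSpace]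
  simp only [dSpace_comm _ i]

theorem box_dTime (f : ScalarDistribution) : box (dTime f) = dTime (box f) := by
  simp only [box, divergence, grad, dTime_sub, dTime_add, dTime_dSpace]

variable {φ : ScalarDistribution} {A : VectorDistribution}

theorem divergence_neg_grad_sub_dTimeVec (lorenz : divergence A + dTime φ = 0) :
    divergence (-grad φ - dTimeVec A) = -box φ := by
  have hA : dTime (divergence A) = -dTime (dTime φ) := by
    rw [eq_neg_of_add_eq_zero_left lorenz, dTime_neg]
  simp only [divergence, box, grad, dTimeVec, Pi.sub_apply, Pi.neg_apply, dSpace_sub, dSpace_neg,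
    dTime_add, dTime_dSpace] at hA ⊢
  rw [neg_sub, sub_eq_add_neg _ (_ + _ + _), ← neg_eq_iff_eq_neg.2 hA]
  abel

theorem curl_neg_grad_sub_dTimeVec (φ : ScalarDistribution) (A : VectorDistribution) :
    curl (-grad φ - dTimeVec A) = -dTimeVec (curl A) := by
  ext1 i
  fin_cases i <;>
  simp only [curl, grad, dTimeVec, Pi.sub_apply, Pi.neg_apply, dSpace_sub, dSpace_neg, dTime_sub,
    dTime_dSpace, Fin.zero_eta, Fin.mk_one, Fin.reduceFinMk, Matrix.cons_val]
  · rw [dSpace_comm 1 2]; abel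
  · rw [dSpace_comm 2 0]; abel
  · rw [dSpace_comm 0 1]; abel

theorem divergence_curl (A : VectorDistribution) : divergence (curl A) = 0 := by
  simp only [divergence, curl, Matrix.cons_val, dSpace_sub]
  rw [dSpace_comm 1 0, dSpace_comm 2 0, dSpace_comm 2 1]
  abel

theorem curl_curl (A : VectorDistribution) :
    curl (curl A) = grad (divergence A) - dTimeVec (dTimeVec A) - boxVec A := by
  ext1 i
  fin_cases i <;>
  simp only [curl, boxVec, box, divergence, grad, dTimeVec, Pi.sub_apply, dSpace_add, dSpace_sub,
    Fin.zero_eta, Fin.mk_one, Fin.reduceFinMk, Matrix.cons_val]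
  · rw [dSpace_comm 1 0, dSpace_comm 2 0]; abel
  · rw [dSpace_comm 2 1, dSpace_comm 0 1]; abel
  · rw [dSpace_comm 0 2, dSpace_comm 1 2]; abel

theorem curl_curl_of_lorenz (lorenz : divergence A + dTime φ = 0) :
    curl (curl A) = dTimeVec (-grad φ - dTimeVec A) + -boxVec A := by
  rw [curl_curl, eq_neg_of_add_eq_zero_left lorenz]
  ext1 i
  simp only [grad, dTimeVec, Pi.add_apply, Pi.sub_apply, Pi.neg_apply, dSpace_neg, dTime_sub,
    dTime_neg, dTime_dSpace]
  abel

theorem divergence_boxVec (A : VectorDistribution) :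
    divergence (boxVec A) = box (divergence A) := by
  simp only [divergence, boxVec, box_add, box_dSpace]

theorem continuity_of_lorenz (lorenz : divergence A + dTime φ = 0) :
    divergence (-boxVec A) + dTime (-box φ) = 0 := by
  have box_zero : box (0 : ScalarDistribution) = 0 := by simpa using box_add 0 0
  have divergence_neg : divergence (-boxVec A) = -divergence (boxVec A) := by
    simp only [divergence, Pi.neg_apply, dSpace_neg]
    abel
  rw [divergence_neg, divergence_boxVec, dTime_neg, ← neg_add, ← box_dTime, ← box_add, lorenz,
    box_zero, neg_zero]

end Maxwell

/-! ### Charge integrals -/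

section WeightedIntegral

variable {E : Type*} [NormedAddCommGroup E] [NormedSpace ℝ E] {Ω : Opens E}

theorem integrable_testFunction_mul [MeasurableSpace E] [OpensMeasurableSpace E] {μ : Measure E}
    {f : E → ℝ} (hf : LocallyIntegrable f μ) (g : 𝓓(Ω, ℝ)) : Integrable (fun x => g x * f x) μ := by
  simpa using TestFunction.integrable_bilin (𝕜 := ℝ) (ContinuousLinearMap.mul ℝ ℝ)
    (hf.locallyIntegrableOn _) g

theorem norm_integral_mul_le_of_support_subset {X : Type*} [MeasurableSpace X] {μ : Measure X}
    {f g : X → ℝ} {K : Set X} {b C : ℝ≥0} (hg : ∀ x, ‖g x‖ ≤ b) (hK : Function.support g ⊆ K)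
    (hf : ∫⁻ x in K, ‖f x‖ₑ ∂μ ≤ C) : ‖∫ x, g x * f x ∂μ‖ ≤ b * C := by
  have h_restrict : ∫ x, g x * f x ∂μ = ∫ x in K, g x * f x ∂μ :=
    (setIntegral_eq_integral_of_forall_compl_eq_zero fun x hx => by
      rw [Function.notMem_support.1 fun h => hx (hK h), zero_mul]).symm
  have h_enorm : ‖∫ x in K, g x * f x ∂μ‖ₑ ≤ b * C :=
    calc ‖∫ x in K, g x * f x ∂μ‖ₑ ≤ ∫⁻ x in K, ‖g x * f x‖ₑ ∂μ :=
          enorm_integral_le_lintegral_enorm _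
      _ ≤ ∫⁻ x in K, b * ‖f x‖ₑ ∂μ := lintegral_mono fun x => by
          rw [enorm_mul]
          gcongr
          exact ENNReal.coe_le_coe.2 (hg x)
      _ = b * ∫⁻ x in K, ‖f x‖ₑ ∂μ := lintegral_const_mul' _ _ ENNReal.coe_ne_top
      _ ≤ b * C := by gcongr
  rw [h_restrict]
  exact_mod_cast h_enorm

theorem exists_distribution_eq_of_bound {V : Type*} [NormedAddCommGroup V] [NormedSpace ℝ V]
    (L : 𝓓(Ω, ℝ) →ₗ[ℝ] V)
    (hL : ∀ K ⊆ (Ω : Set E), IsCompact K → ∃ C : ℝ≥0, ∀ (g : 𝓓(Ω, ℝ)) (b : ℝ≥0),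
      (∀ x, ‖g x‖ ≤ b) → Function.support g ⊆ K → ‖L g‖ ≤ C * b) :
    ∃ H : 𝓓'(Ω, V), ∀ g, H g = L g := by
  refine ⟨TestFunction.mkCLM ℝ L (map_add L) (map_smul L) fun K hK => ?_, fun g => rfl⟩
  obtain ⟨C, hC⟩ := hL K hK K.isCompact
  refine (ContDiffMapSupportedIn.mkCLMtoNormedSpace (𝕜 := ℝ)
    (L ∘ TestFunction.ofSupportedIn hK)
    (fun g g' => map_add L (TestFunction.ofSupportedIn hK g) (TestFunction.ofSupportedIn hK g'))
    (fun c g => map_smul L c (TestFunction.ofSupportedIn hK g))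
    ⟨{0}, C, C.2, fun g => ?_⟩).continuous
  rw [Finset.sup_singleton]
  exact hC _ ⟨_, apply_nonneg _ g⟩
    (fun x => ContDiffMapSupportedIn.norm_apply_le_seminorm ℝ (f := g))
    fun x hx => by_contra fun hxK => hx (g.zero_on_compl hxK)

end WeightedIntegral

/-- A family of functions whose `L¹` norms on each compact set are bounded by one finite constant:
the domination under which the integral of the family against a finite measure is a
distribution. -/
def UniformlyLocallyIntegrable {ι X V : Type*} [TopologicalSpace X] [MeasureSpace X]
    [NormedAddCommGroup V] (f : ι → X → V) : Prop :=
  ∀ K : Set X, IsCompact K → ∃ C : ℝ≥0, ∀ i, ∫⁻ x in K, ‖f i x‖ₑ ≤ C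

theorem UniformlyLocallyIntegrable.locallyIntegrable {ι X V : Type*} [TopologicalSpace X]
    [LocallyCompactSpace X] [MeasureSpace X] [NormedAddCommGroup V] {f : ι → X → V}
    (hf : UniformlyLocallyIntegrable f) {i : ι} (hm : AEStronglyMeasurable (f i)) :
    LocallyIntegrable (f i) := by
  refine locallyIntegrable_iff.2 fun K hK => ⟨hm.restrict, ?_⟩
  obtain ⟨C, hC⟩ := hf K hK
  exact (hC i).trans_lt ENNReal.coe_lt_top

section ChargeIntegral

variable {F : Set Space} {q : SignedMeasure F} {f f' : F → SpaceTime → ℝ}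
  {H H' : ScalarDistribution}

instance isFiniteMeasure_variation (q : SignedMeasure F) : IsFiniteMeasure q.variation := by
  rw [← SignedMeasure.totalVariation_eq_variation]
  infer_instance

theorem stronglyMeasurable_integral_testFunction_mul (hm : Measurable (Function.uncurry f))
    (g : 𝓓((⊤ : Opens SpaceTime), ℝ)) : StronglyMeasurable fun r₀ => ∫ x, g x * f r₀ x :=
  StronglyMeasurable.integral_prod_right (f := fun r₀ x => g x * f r₀ x)
    ((g.continuous.measurable.comp measurable_snd).mul hm).stronglyMeasurable

theorem UniformlyLocallyIntegrable.integrable_integral_testFunction_mul (q : SignedMeasure F)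
    (hf : UniformlyLocallyIntegrable f) (hm : Measurable (Function.uncurry f))
    (g : 𝓓((⊤ : Opens SpaceTime), ℝ)) : q.Integrable fun r₀ => ∫ x, g x * f r₀ x := by
  obtain ⟨C, hC⟩ := hf _ g.hasCompactSupport
  obtain ⟨b, hb⟩ := g.hasCompactSupport.exists_bound_of_continuous g.continuous
  exact Integrable.of_bound
    (stronglyMeasurable_integral_testFunction_mul hm g).aestronglyMeasurable _ <|
    .of_forall fun r₀ => norm_integral_mul_le_of_support_subset
      (b := ⟨b, (norm_nonneg _).trans (hb 0)⟩) hb (subset_tsupport g) (hC r₀)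

/-- The functional `g ↦ ∫_F ⟨f(·, r₀), g⟩ q(dr₀)`. -/
def chargeFunctional (q : SignedMeasure F) (f : F → SpaceTime → ℝ)
    (hloc : ∀ r₀, LocallyIntegrable (f r₀))
    (hint : ∀ g : 𝓓((⊤ : Opens SpaceTime), ℝ), q.Integrable fun r₀ => ∫ x, g x * f r₀ x) :
    𝓓((⊤ : Opens SpaceTime), ℝ) →ₗ[ℝ] ℝ where
  toFun g := ∫ᵛ r₀, (∫ x, g x * f r₀ x) ∂•q
  map_add' g g' := by
    rw [← VectorMeasure.integral_fun_add (hint g) (hint g')]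
    congr 1 with r₀
    rw [← integral_add (integrable_testFunction_mul (hloc r₀) g)
      (integrable_testFunction_mul (hloc r₀) g')]
    simp only [FunLike.coe_add, Pi.add_apply, add_mul]
  map_smul' c g := by
    rw [← VectorMeasure.integral_fun_smul]
    congr 1 with r₀
    rw [RingHom.id_apply, smul_eq_mul, ← integral_const_mul]
    simp only [FunLike.coe_smul, Pi.smul_apply, smul_eq_mul, mul_assoc]

theorem exists_isChargeIntegral (q : SignedMeasure F) (hf : UniformlyLocallyIntegrable f)
    (hm : Measurable (Function.uncurry f)) : ∃ H : ScalarDistribution, IsChargeIntegral q f H := by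
  have hloc (r₀ : F) : LocallyIntegrable (f r₀) :=
    hf.locallyIntegrable (hm.comp measurable_prodMk_left).aestronglyMeasurable
  have hint := hf.integrable_integral_testFunction_mul q hm
  have hbound (K : Set SpaceTime) (_ : K ⊆ (⊤ : Opens SpaceTime)) (hK : IsCompact K) :
      ∃ C : ℝ≥0, ∀ (g : 𝓓((⊤ : Opens SpaceTime), ℝ)) (b : ℝ≥0), (∀ x, ‖g x‖ ≤ b) →
        Function.support g ⊆ K → ‖chargeFunctional q f hloc hint g‖ ≤ C * b := by
    obtain ⟨C, hC⟩ := hf K hK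
    refine ⟨C * ‖ContinuousLinearMap.lsmul ℝ ℝ (E := ℝ)‖₊ * measureUnivNNReal q.variation,
      fun g b hb hgK => ?_⟩
    calc ‖chargeFunctional q f hloc hint g‖
        ≤ b * C * ‖ContinuousLinearMap.lsmul ℝ ℝ (E := ℝ)‖ * q.variation.real univ :=
          VectorMeasure.norm_integral_le_of_norm_le_const (Eventually.of_forall fun r₀ =>
            norm_integral_mul_le_of_support_subset hb hgK (hC r₀))
      _ = _ := by
          change _ * (measureUnivNNReal q.variation : ℝ) = _
          push_cast
          ring
  obtain ⟨H, hH⟩ := exists_distribution_eq_of_bound (chargeFunctional q f hloc hint) hbound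
  exact ⟨H, hloc, fun g => ⟨hint g, hH g⟩⟩

namespace IsChargeIntegral

theorem add (hf : IsChargeIntegral q f H) (hf' : IsChargeIntegral q f' H') :
    IsChargeIntegral q (fun r₀ x => f r₀ x + f' r₀ x) (H + H') := by
  refine ⟨fun r₀ => (hf.1 r₀).add (hf'.1 r₀), fun g => ?_⟩
  have integral_add_eq (r₀ : F) : ∫ x, g x * (f r₀ x + f' r₀ x) =
      (∫ x, g x * f r₀ x) + ∫ x, g x * f' r₀ x := by
    rw [← integral_add (integrable_testFunction_mul (hf.1 r₀) g)
      (integrable_testFunction_mul (hf'.1 r₀) g)]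
    simp only [mul_add]
  simp only [integral_add_eq]
  refine ⟨(hf.2 g).1.add (hf'.2 g).1, ?_⟩
  rw [VectorMeasure.integral_fun_add (hf.2 g).1 (hf'.2 g).1, ← (hf.2 g).2, ← (hf'.2 g).2]
  rfl

theorem neg (hf : IsChargeIntegral q f H) : IsChargeIntegral q (fun r₀ x => -f r₀ x) (-H) := by
  refine ⟨fun r₀ => (hf.1 r₀).neg, fun g => ?_⟩
  simp only [mul_neg, integral_neg]
  refine ⟨(hf.2 g).1.neg, ?_⟩
  rw [VectorMeasure.integral_fun_neg, ← (hf.2 g).2]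
  rfl

theorem sub (hf : IsChargeIntegral q f H) (hf' : IsChargeIntegral q f' H') :
    IsChargeIntegral q (fun r₀ x => f r₀ x - f' r₀ x) (H - H') := by
  simpa only [sub_eq_add_neg] using hf.add hf'.neg

theorem congr_ae (hf : IsChargeIntegral q f H) (hff' : ∀ r₀, f r₀ =ᵐ[volume] f' r₀) :
    IsChargeIntegral q f' H := by
  refine ⟨fun r₀ => (hf.1 r₀).congr (hff' r₀), fun g => ?_⟩
  have integral_eq (r₀ : F) : ∫ x, g x * f' r₀ x = ∫ x, g x * f r₀ x :=
    integral_congr_ae ((hff' r₀).mono fun x hx => by simp only [hx])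
  simpa only [integral_eq] using hf.2 g

theorem eq_zero (hf : IsChargeIntegral q f H) (hf0 : ∀ r₀, f r₀ =ᵐ[volume] 0) : H = 0 := by
  ext g
  rw [((hf.congr_ae hf0).2 g).2]
  simp

theorem lineDerivOp (hf : IsChargeIntegral q f H) {d : SpaceTime}
    (hf' : ∀ r₀, LocallyIntegrable (f' r₀))
    (hd : ∀ r₀ (g : 𝓓((⊤ : Opens SpaceTime), ℝ)),
      ∫ x, (∂_{d} g) x * f r₀ x = -∫ x, g x * f' r₀ x) :
    IsChargeIntegral q f' (∂_{d} H) := by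
  refine ⟨hf', fun g => ?_⟩
  have integral_eq (r₀ : F) : ∫ x, g x * f' r₀ x = -∫ x, (∂_{d} g) x * f r₀ x := by
    rw [hd, neg_neg]
  simp only [integral_eq]
  refine ⟨(hf.2 _).1.neg, ?_⟩
  rw [VectorMeasure.integral_fun_neg, ← (hf.2 _).2, Distribution.lineDerivOp_apply_apply, map_neg]

end IsChargeIntegral

end ChargeIntegral

/-! ### Inverse powers of the distance to a moving point -/

section InverseDistance

variable {E : Type*} [NormedAddCommGroup E] [MeasurableSpace E] [BorelSpace E] (μ : Measure E)

theorem integrableOn_ball_inv_norm_pow [NormedSpace ℝ E] [FiniteDimensional ℝ E]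
    [μ.IsAddHaarMeasure] {k : ℕ} (hk : k < finrank ℝ E) (ρ : ℝ) :
    IntegrableOn (fun w : E => ‖w‖⁻¹ ^ k) (Metric.ball 0 ρ) μ := by
  have : Nontrivial E := Module.nontrivial_of_finrank_pos (R := ℝ) (by omega)
  rw [integrableOn_fun_norm_addHaar μ (f := fun y : ℝ => y⁻¹ ^ k)]
  have h_pow : IntegrableOn (fun y : ℝ => y ^ (finrank ℝ E - 1 - k)) (Ioo 0 ρ) :=
    ((continuous_pow _).continuousOn.integrableOn_Icc (a := 0) (b := ρ)).mono_set
      Ioo_subset_Icc_self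
  refine h_pow.congr_fun (fun y hy => ?_) measurableSet_Ioo
  change y ^ (finrank ℝ E - 1 - k) = y ^ (finrank ℝ E - 1) * y⁻¹ ^ k
  rw [inv_pow, pow_sub₀ _ hy.1.ne' (by omega)]

theorem setLIntegral_inv_norm_sub_pow_le [μ.IsAddRightInvariant] (k : ℕ) (s : Set E) (a : E) :
    ∫⁻ r in s, ‖‖r - a‖⁻¹ ^ k‖ₑ ∂μ ≤ ∫⁻ w in Metric.ball 0 1, ‖‖w‖⁻¹ ^ k‖ₑ ∂μ + μ s := by
  set near : E → ℝ≥0∞ := (Metric.ball 0 1).indicator fun w => ‖‖w‖⁻¹ ^ k‖ₑ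
  have h_split (r : E) : ‖‖r - a‖⁻¹ ^ k‖ₑ ≤ near (r - a) + 1 := by
    by_cases hr : r - a ∈ Metric.ball 0 1
    · simp only [near, indicator_of_mem hr, le_self_add]
    · have hr1 : 1 ≤ ‖r - a‖ := by simpa using hr
      have h_far : ‖r - a‖⁻¹ ^ k ≤ 1 := pow_le_one₀ (by positivity) (inv_le_one_of_one_le₀ hr1)
      rw [Real.enorm_of_nonneg (by positivity)]
      exact le_add_left (ENNReal.ofReal_le_one.2 h_far)
  calc ∫⁻ r in s, ‖‖r - a‖⁻¹ ^ k‖ₑ ∂μ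
      ≤ ∫⁻ r in s, (near (r - a) + 1) ∂μ := lintegral_mono h_split
    _ = ∫⁻ r in s, near (r - a) ∂μ + μ s := by
        rw [lintegral_add_right _ measurable_const, setLIntegral_one]
    _ ≤ ∫⁻ r, near (r - a) ∂μ + μ s := by gcongr; exact Measure.restrict_le_self
    _ = _ := by
        rw [lintegral_sub_right_eq_self near, lintegral_indicator Metric.isOpen_ball.measurableSet]

theorem setLIntegral_prod_inv_norm_sub_pow_le [SecondCountableTopology E] [SFinite μ]
    [μ.IsAddRightInvariant] {Y : Type*} [MeasurableSpace Y] (ν : Measure Y) [SFinite ν] {a : Y → E}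
    (k : ℕ) (ha : Measurable a) (s : Set E) (t : Set Y) :
    ∫⁻ x in s ×ˢ t, ‖‖x.1 - a x.2‖⁻¹ ^ k‖ₑ ∂μ.prod ν ≤
      (∫⁻ w in Metric.ball 0 1, ‖‖w‖⁻¹ ^ k‖ₑ ∂μ + μ s) * ν t := by
  rw [← Measure.prod_restrict, lintegral_prod_symm' _ (by fun_prop)]
  refine (lintegral_mono fun y => setLIntegral_inv_norm_sub_pow_le μ k s (a y)).trans ?_
  rw [lintegral_const, Measure.restrict_apply_univ]

end InverseDistance

theorem ae_prod_fst_ne {X Y : Type*} [MeasurableSpace X] [MeasurableEq X] [MeasurableSpace Y]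
    (μ : Measure X) [SFinite μ] [NullSingletonClass μ] (ν : Measure Y) [SFinite ν] {a : Y → X}
    (ha : Measurable a) : ∀ᵐ x ∂μ.prod ν, x.1 ≠ a x.2 := by
  have hs : MeasurableSet {x : X × Y | x.1 = a x.2} :=
    measurableSet_eq_fun measurable_fst (ha.comp measurable_snd)
  rw [ae_iff]
  simp only [ne_eq, not_not]
  rw [Measure.prod_apply_symm hs]
  simp

/-! ### Integration by parts across a null singular set -/

/-- A smooth function of one variable that vanishes on `(-∞, 1]` and equals `1` on `[2, ∞)`. For
`T` vanishing on a singular set, `cutoff (n * T x)` vanishes near that set and converges to `1`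
elsewhere as `n → ∞`. -/
def cutoff (s : ℝ) : ℝ := Real.smoothTransition (s - 1)

theorem contDiff_cutoff : ContDiff ℝ 1 cutoff :=
  Real.smoothTransition.contDiff.comp (contDiff_id.sub contDiff_const)

theorem cutoff_of_le_one {s : ℝ} (hs : s ≤ 1) : cutoff s = 0 :=
  Real.smoothTransition.zero_of_nonpos (by linarith)

theorem cutoff_of_two_le {s : ℝ} (hs : 2 ≤ s) : cutoff s = 1 :=
  Real.smoothTransition.one_of_one_le (by linarith)

theorem norm_cutoff_le_one (s : ℝ) : ‖cutoff s‖ ≤ 1 := by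
  rw [cutoff, Real.norm_of_nonneg (Real.smoothTransition.nonneg _)]
  exact Real.smoothTransition.le_one _

theorem deriv_cutoff_of_notMem_Icc {s : ℝ} (hs : s ∉ Icc (1 : ℝ) 2) : deriv cutoff s = 0 := by
  rcases not_and_or.1 hs with hs | hs
  · have : cutoff =ᶠ[𝓝 s] fun _ => 0 := by
      filter_upwards [Iio_mem_nhds (not_le.1 hs)] with y hy using cutoff_of_le_one (le_of_lt hy)
    rw [this.deriv_eq, deriv_const]
  · have : cutoff =ᶠ[𝓝 s] fun _ => 1 := by
      filter_upwards [Ioi_mem_nhds (not_le.1 hs)] with y hy using cutoff_of_two_le (le_of_lt hy)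
    rw [this.deriv_eq, deriv_const]

theorem continuous_mul_deriv_cutoff : Continuous fun s => s * deriv cutoff s :=
  continuous_id.mul (contDiff_cutoff.continuous_deriv le_rfl)

theorem exists_norm_mul_deriv_cutoff_le : ∃ b, ∀ s, ‖s * deriv cutoff s‖ ≤ b :=
  (HasCompactSupport.intro isCompact_Icc fun s hs => by
    rw [deriv_cutoff_of_notMem_Icc hs, mul_zero]).exists_bound_of_continuous
      continuous_mul_deriv_cutoff

theorem tendsto_cutoff_atTop : Tendsto cutoff atTop (𝓝 1) :=
  tendsto_const_nhds.congr' ((eventually_ge_atTop 2).mono fun _ hs => (cutoff_of_two_le hs).symm)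

theorem tendsto_mul_deriv_cutoff_atTop : Tendsto (fun s => s * deriv cutoff s) atTop (𝓝 0) :=
  tendsto_const_nhds.congr' <| by
    filter_upwards [eventually_gt_atTop 2] with s hs
    rw [deriv_cutoff_of_notMem_Icc fun h => hs.not_ge h.2, mul_zero]

section Limit

variable {X : Type*} [MeasurableSpace X] {μ : Measure X} {T h : X → ℝ} {c : ℝ → ℝ} {b : ℝ}

theorem integrable_comp_mul (hT : Measurable T) (hh : Integrable h μ) (hc : Continuous c)
    (hb : ∀ s, ‖c s‖ ≤ b) (n : ℝ) : Integrable (fun x => c (n * T x) * h x) μ :=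
  hh.bdd_mul (hc.measurable.comp (hT.const_mul n)).aestronglyMeasurable
    (Eventually.of_forall fun _ => hb _)

theorem tendsto_integral_comp_mul (hT : Measurable T) (hT0 : ∀ᵐ x ∂μ, 0 < T x)
    (hh : Integrable h μ) (hc : Continuous c) (hb : ∀ s, ‖c s‖ ≤ b) {l : ℝ}
    (hl : Tendsto c atTop (𝓝 l)) :
    Tendsto (fun n : ℕ => ∫ x, c (n * T x) * h x ∂μ) atTop (𝓝 (∫ x, l * h x ∂μ)) := by
  refine tendsto_integral_of_dominated_convergence (fun x => b * ‖h x‖)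
    (fun n => (integrable_comp_mul hT hh hc hb n).aestronglyMeasurable) (hh.norm.const_mul b)
    (fun n => Eventually.of_forall fun x => ?_) ?_
  · rw [norm_mul]
    exact mul_le_mul_of_nonneg_right (hb _) (norm_nonneg _)
  · filter_upwards [hT0] with x hx
    exact (hl.comp (tendsto_natCast_atTop_atTop.atTop_mul_const hx)).mul_const (h x)

end Limit

section IntegrationByParts

variable {E : Type*} [NormedAddCommGroup E] [NormedSpace ℝ E] {T f f' T' : E → ℝ} {d : E}

theorem hasLineDerivAt_cutoff_mul (hT : Continuous T)
    (hTd : ∀ x, 0 < T x → HasLineDerivAt ℝ T (T' x) x d)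
    (hfd : ∀ x, 0 < T x → HasLineDerivAt ℝ f (f' x) x d) (n : ℕ) (x : E) :
    HasLineDerivAt ℝ (fun y => cutoff (n * T y) * f y)
      (cutoff (n * T x) * f' x +
        n * T x * deriv cutoff (n * T x) * (f x * T' x * (T x)⁻¹)) x d := by
  rcases le_or_gt (T x) 0 with hx | hx
  · have hnx : n * T x < 1 :=
      (mul_nonpos_of_nonneg_of_nonpos n.cast_nonneg hx).trans_lt one_pos
    have h_near : (fun y => cutoff (n * T y) * f y) =ᶠ[𝓝 x] fun _ => 0 := by
      filter_upwards [(hT.const_mul (n : ℝ)).continuousAt.eventually_lt_const hnx] with y hy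
      rw [cutoff_of_le_one (le_of_lt hy), zero_mul]
    have h_zero : HasLineDerivAt ℝ (fun y => cutoff (n * T y) * f y) 0 x d :=
      ((hasFDerivAt_const (0 : ℝ) x).hasLineDerivAt d).congr_of_eventuallyEq h_near
    rwa [cutoff_of_le_one hnx.le, deriv_cutoff_of_notMem_Icc fun h => hnx.not_ge h.1, mul_zero,
      zero_mul, zero_mul, add_zero]
  · have h_cutoff : HasDerivAt (fun s : ℝ => cutoff (n * T (x + s • d)))
        (deriv cutoff (n * T x) * (n * T' x)) 0 := by
      have h_outer := (contDiff_cutoff.differentiable one_ne_zero (n * T x)).hasDerivAt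
      exact h_outer.comp_of_eq 0 (HasDerivAt.const_mul (n : ℝ) (hTd x hx)) (by simp)
    refine HasDerivAt.congr_deriv (h_cutoff.mul (hfd x hx)) ?_
    simp only [zero_smul, add_zero]
    field_simp
    ring

variable [FiniteDimensional ℝ E] [MeasurableSpace E] [BorelSpace E] {μ : Measure E}
  [μ.IsAddHaarMeasure] {Ω : Opens E}

theorem integral_cutoff_mul_testFunction_lineDeriv_mul (hT : Continuous T)
    (hTd : ∀ x, 0 < T x → HasLineDerivAt ℝ T (T' x) x d)
    (hfd : ∀ x, 0 < T x → HasLineDerivAt ℝ f (f' x) x d)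
    (hf : LocallyIntegrable f μ) (hf' : LocallyIntegrable f' μ)
    (hfT : LocallyIntegrable (fun x => f x * T' x * (T x)⁻¹) μ) (g : 𝓓(Ω, ℝ)) (n : ℕ) :
    ∫ x, cutoff (n * T x) * ((∂_{d} g) x * f x) ∂μ =
      -((∫ x, cutoff (n * T x) * (g x * f' x) ∂μ) + ∫ x, n * T x * deriv cutoff (n * T x) *
        (g x * (f x * T' x * (T x)⁻¹)) ∂μ) := by
  obtain ⟨b, hb⟩ := exists_norm_mul_deriv_cutoff_le
  have hgd (x : E) : HasLineDerivAt ℝ g ((∂_{d} g) x) x d := by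
    rw [testFunction_lineDerivOp_apply]
    exact (g.contDiff.differentiable (by simp) x).hasFDerivAt.hasLineDerivAt d
  have cut {h : E → ℝ} (hh : LocallyIntegrable h μ) (g : 𝓓(Ω, ℝ)) :=
    integrable_comp_mul hT.measurable (integrable_testFunction_mul hh g)
      contDiff_cutoff.continuous norm_cutoff_le_one n
  have cut_deriv := integrable_comp_mul hT.measurable (integrable_testFunction_mul hfT g)
    continuous_mul_deriv_cutoff hb n
  rw [← integral_add (cut hf' g) cut_deriv]
  have parts := integral_bilinear_hasLineDerivAt_right_eq_neg_left_of_integrable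
    (μ := μ) (B := ContinuousLinearMap.mul ℝ ℝ)
    (((cut hf' g).add cut_deriv).congr <| .of_forall fun x => by
      simp only [Pi.add_apply, ContinuousLinearMap.mul_apply']; ring)
    ((cut hf (∂_{d} g)).congr <| .of_forall fun x => by
      simp only [ContinuousLinearMap.mul_apply']; ring)
    ((cut hf g).congr <| .of_forall fun x => by
      simp only [ContinuousLinearMap.mul_apply']; ring)
    (fun x _ => hasLineDerivAt_cutoff_mul hT hTd hfd n x) fun x _ => hgd x
  refine (integral_congr_ae <| .of_forall fun x => ?_).trans
    (parts.trans <| congrArg _ <| integral_congr_ae <| .of_forall fun x => ?_) <;>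
  · simp only [ContinuousLinearMap.mul_apply']
    ring

theorem integral_testFunction_lineDeriv_mul (hT : Continuous T) (hT0 : ∀ᵐ x ∂μ, 0 < T x)
    (hTd : ∀ x, 0 < T x → HasLineDerivAt ℝ T (T' x) x d)
    (hfd : ∀ x, 0 < T x → HasLineDerivAt ℝ f (f' x) x d)
    (hf : LocallyIntegrable f μ) (hf' : LocallyIntegrable f' μ)
    (hfT : LocallyIntegrable (fun x => f x * T' x * (T x)⁻¹) μ) (g : 𝓓(Ω, ℝ)) :
    ∫ x, (∂_{d} g) x * f x ∂μ = -∫ x, g x * f' x ∂μ := by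
  obtain ⟨b, hb⟩ := exists_norm_mul_deriv_cutoff_le
  have lim_cutoff {h : E → ℝ} (hh : LocallyIntegrable h μ) (g : 𝓓(Ω, ℝ)) :=
    tendsto_integral_comp_mul hT.measurable hT0 (integrable_testFunction_mul hh g)
      contDiff_cutoff.continuous norm_cutoff_le_one tendsto_cutoff_atTop
  have lim_deriv := tendsto_integral_comp_mul hT.measurable hT0 (integrable_testFunction_mul hfT g)
    continuous_mul_deriv_cutoff hb tendsto_mul_deriv_cutoff_atTop
  simpa using tendsto_nhds_unique
    ((lim_cutoff hf (∂_{d} g)).congr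
      (integral_cutoff_mul_testFunction_lineDeriv_mul hT hTd hfd hf hf' hfT g))
    ((lim_cutoff hf' g).add lim_deriv).neg

end IntegrationByParts

/-! ### The retarded time -/

section Retardation

variable {E : Type*} [NormedAddCommGroup E] {a : ℝ → E} {t : ℝ} {K : ℝ≥0}

theorem exists_eq_norm_sub_retarded (hK : K < 1) (ha : LipschitzOnWith K a (Iic t)) (r : E) :
    ∃ T, T = ‖r - a (t - T)‖ := by
  have hK' : 0 < 1 - (K : ℝ) := sub_pos.2 (by exact_mod_cast hK)
  set T₁ : ℝ := ‖r - a t‖ / (1 - K)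
  have hT₁ : 0 ≤ T₁ := by positivity
  have h_maps : MapsTo (fun T : ℝ => t - T) (Icc 0 T₁) (Iic t) := fun T hT => by
    simpa using hT.1
  have h_cont : ContinuousOn (fun T => T - ‖r - a (t - T)‖) (Icc 0 T₁) :=
    continuousOn_id.sub (continuousOn_const.sub <|
      ha.continuousOn.comp (by fun_prop) h_maps).norm
  have h_end : ‖r - a (t - T₁)‖ ≤ T₁ := calc
    ‖r - a (t - T₁)‖ ≤ ‖r - a t‖ + ‖a t - a (t - T₁)‖ := norm_sub_le_norm_sub_add_norm_sub _ _ _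
    _ ≤ ‖r - a t‖ + K * T₁ := by
      gcongr
      simpa [dist_eq_norm, abs_of_nonneg hT₁] using
        ha.dist_le_mul t self_mem_Iic (t - T₁) (by simpa using hT₁)
    _ = T₁ := by simp only [T₁]; field_simp; ring
  obtain ⟨T, -, hT⟩ := intermediate_value_Icc hT₁ h_cont
    (show (0 : ℝ) ∈ Icc _ _ from ⟨by simp, sub_nonneg.2 h_end⟩)
  exact ⟨T, sub_eq_zero.1 hT⟩

theorem mul_abs_sub_le_of_eq_norm_sub_retarded (ha : LipschitzOnWith K a (Iic t)) {r : E}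
    {T S : ℝ} (hT : T = ‖r - a (t - T)‖) (hS : 0 ≤ S) :
    (1 - K) * |T - S| ≤ |‖r - a (t - S)‖ - S| := by
  have hT0 : 0 ≤ T := hT ▸ norm_nonneg _
  have h_lip : |T - ‖r - a (t - S)‖| ≤ K * |T - S| := calc
    |T - ‖r - a (t - S)‖| = |‖r - a (t - T)‖ - ‖r - a (t - S)‖| := by rw [← hT]
    _ ≤ ‖a (t - T) - a (t - S)‖ := by
      simpa [norm_sub_rev] using abs_norm_sub_norm_le (r - a (t - T)) (r - a (t - S))
    _ ≤ K * |T - S| := by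
      simpa [dist_eq_norm, abs_sub_comm] using
        ha.dist_le_mul (t - T) (by simpa using hT0) (t - S) (by simpa using hS)
  linarith [abs_sub_le T ‖r - a (t - S)‖ S]

end Retardation

section ImplicitDerivative

variable {E : Type*} [NormedAddCommGroup E] [InnerProductSpace ℝ E] {a : ℝ → E} {v e : E}

theorem hasFDerivAt_norm {w : E} (hw : w ≠ 0) :
    HasFDerivAt (fun y : E => ‖y‖) (innerSL ℝ (‖w‖⁻¹ • w)) w := by
  have h := (hasStrictFDerivAt_norm_sq w).hasFDerivAt.sqrt (by positivity)
  simp only [Real.sqrt_sq (norm_nonneg _)] at h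
  refine h.congr_fderiv (ContinuousLinearMap.ext fun y => ?_)
  simp only [one_div, mul_inv_rev, smul_apply, coe_innerSL_apply, nsmul_eq_mul,
    Nat.cast_ofNat, smul_eq_mul, map_smul]
  field_simp

theorem hasFDerivAt_retarded {τ : E × ℝ → ℝ} {x : E × ℝ}
    (hτ : ∀ y, τ y + ‖y.1 - a (τ y)‖ = y.2) (hτc : ContinuousAt τ x)
    (ha : HasDerivAt a v (τ x)) (hx : x.1 ≠ a (τ x))
    (he : e = ‖x.1 - a (τ x)‖⁻¹ • (x.1 - a (τ x))) (hev : 1 - inner ℝ e v ≠ 0) :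
    HasFDerivAt τ ((1 - inner ℝ e v)⁻¹ • (ContinuousLinearMap.snd ℝ E ℝ -
      (innerSL ℝ e).comp (ContinuousLinearMap.fst ℝ E ℝ))) x := by
  let Φ' : (E × ℝ) ≃L[ℝ] E × ℝ := (ContinuousLinearEquiv.refl ℝ E).skewProd
    (ContinuousLinearEquiv.unitsEquivAut ℝ (Units.mk0 _ hev)) (innerSL ℝ e)
  have h_norm : HasFDerivAt (fun w : E => ‖w‖) (innerSL ℝ e) (x.1 - a (τ x)) :=
    he ▸ hasFDerivAt_norm (sub_ne_zero.2 hx)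
  have h_diff : HasFDerivAt (fun p : E × ℝ => p.1 - a p.2)
      (ContinuousLinearMap.fst ℝ E ℝ - (ContinuousLinearMap.toSpanSingleton ℝ v).comp
        (ContinuousLinearMap.snd ℝ E ℝ)) (x.1, τ x) :=
    hasFDerivAt_fst.sub (ha.hasFDerivAt.comp (x.1, τ x) hasFDerivAt_snd)
  have hΦ : HasFDerivAt (fun p : E × ℝ => (p.1, p.2 + ‖p.1 - a p.2‖)) (Φ' : E × ℝ →L[ℝ] E × ℝ)
      (x.1, τ x) := by
    refine (hasFDerivAt_fst.prodMk
      (hasFDerivAt_snd.add (h_norm.comp (x.1, τ x) h_diff))).congr_fderiv ?_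
    ext y <;> simp [Φ', sub_eq_add_neg]
  have h_inv := (HasFDerivAt.of_local_left_inverse (g := fun y => (y.1, τ y))
    (continuousAt_fst.prodMk hτc) hΦ (.of_forall fun y => Prod.ext rfl (hτ y))).snd
  refine h_inv.congr_fderiv (ContinuousLinearMap.ext fun y => ?_)
  simp [Φ', mul_comm]

end ImplicitDerivative

section TimeDelay

variable {F : Set Space} {r₂ : ℝ → F → Space}

/-- A weakening of `IsFlowOfMatter`: a jointly continuous family of twice continuously
differentiable motions, over an arbitrary label set, whose speeds are bounded away from the speed of
light on every half-line `t ≤ t₁`. -/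
structure IsSubluminalMotion (r₂ : ℝ → F → Space) : Prop where
  contDiff : ∀ r₀ : F, ContDiff ℝ 2 fun t => r₂ t r₀
  continuous : Continuous fun p : ℝ × F => r₂ p.1 p.2
  speed_le : ∀ t₁ : ℝ, ∃ v₁ : ℝ≥0, v₁ < 1 ∧
    ∀ t ≤ t₁, ∀ r₀ : F, ‖deriv (fun s => r₂ s r₀) t‖₊ ≤ v₁

theorem IsFlowOfMatter.isSubluminalMotion {t₀ : ℝ} (h : IsFlowOfMatter F t₀ r₂) :
    IsSubluminalMotion r₂ where
  contDiff r₀ := (h.contDiff r₀).of_le (WithTop.coe_le_coe.2 le_top)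
  continuous := by simpa only [iteratedDeriv_zero] using h.continuous_iteratedDeriv 0
  speed_le t₁ := by
    obtain ⟨v₁, hv₁, hv⟩ := h.speed_le t₁
    exact ⟨v₁.toNNReal, Real.toNNReal_lt_one.2 hv₁, fun t ht r₀ =>
      NNReal.le_toNNReal_of_coe_le (hv t ht r₀)⟩

namespace IsSubluminalMotion

variable (h : IsSubluminalMotion r₂) (r₀ : F) (x : SpaceTime)
include h

theorem differentiable : Differentiable ℝ fun t => r₂ t r₀ :=
  (h.contDiff r₀).differentiable two_ne_zero

theorem exists_lipschitzOnWith (t₁ : ℝ) :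
    ∃ v₁ : ℝ≥0, v₁ < 1 ∧ ∀ r₀, LipschitzOnWith v₁ (fun t => r₂ t r₀) (Iic t₁) := by
  obtain ⟨v₁, hv₁, hv⟩ := h.speed_le t₁
  exact ⟨v₁, hv₁, fun r₀ => (convex_Iic t₁).lipschitzOnWith_of_nnnorm_deriv_le
    (fun t _ => h.differentiable r₀ t) fun t ht => hv t ht r₀⟩

theorem timeDelay_eq : timeDelay r₂ r₀ x = ‖x.1 - r₂ (retardedTime r₂ r₀ x) r₀‖ := by
  obtain ⟨v₁, hv₁, hv⟩ := h.exists_lipschitzOnWith x.2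
  exact Classical.epsilon_spec (p := fun T : ℝ => T = ‖x.1 - r₂ (x.2 - T) r₀‖)
    (exists_eq_norm_sub_retarded hv₁ (hv r₀) x.1)

theorem timeDelay_nonneg : 0 ≤ timeDelay r₂ r₀ x := h.timeDelay_eq r₀ x ▸ norm_nonneg _

theorem retardedTime_le : retardedTime r₂ r₀ x ≤ x.2 := sub_le_self _ (h.timeDelay_nonneg r₀ x)

theorem norm_sub_le_two_mul_timeDelay : ‖x.1 - r₂ x.2 r₀‖ ≤ 2 * timeDelay r₂ r₀ x := by
  obtain ⟨v₁, hv₁, hv⟩ := h.exists_lipschitzOnWith x.2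
  have h_lip : ‖r₂ (retardedTime r₂ r₀ x) r₀ - r₂ x.2 r₀‖ ≤ v₁ * timeDelay r₂ r₀ x := by
    simpa [dist_eq_norm, retardedTime, abs_of_nonneg (h.timeDelay_nonneg r₀ x)] using
      (hv r₀).dist_le_mul _ (h.retardedTime_le r₀ x) _ self_mem_Iic
  calc ‖x.1 - r₂ x.2 r₀‖
      ≤ ‖x.1 - r₂ (retardedTime r₂ r₀ x) r₀‖ + ‖r₂ (retardedTime r₂ r₀ x) r₀ - r₂ x.2 r₀‖ :=
        norm_sub_le_norm_sub_add_norm_sub _ _ _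
    _ ≤ timeDelay r₂ r₀ x + 1 * timeDelay r₂ r₀ x := by
        rw [← h.timeDelay_eq]
        gcongr
        exact h_lip.trans (mul_le_mul_of_nonneg_right (by exact_mod_cast hv₁.le)
          (h.timeDelay_nonneg r₀ x))
    _ = 2 * timeDelay r₂ r₀ x := by ring

theorem continuous_timeDelay :
    Continuous fun p : F × SpaceTime => timeDelay r₂ p.1 p.2 := by
  refine continuous_iff_continuousAt.2 fun p₀ => ?_
  obtain ⟨v₁, hv₁, hv⟩ := h.exists_lipschitzOnWith (p₀.2.2 + 1)
  have hv₁' : 0 < 1 - (v₁ : ℝ) := sub_pos.2 (by exact_mod_cast hv₁)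
  set S := timeDelay r₂ p₀.1 p₀.2
  have h_near : ∀ᶠ p : F × SpaceTime in 𝓝 p₀, p.2.2 ≤ p₀.2.2 + 1 :=
    (continuous_snd.snd.tendsto p₀).eventually_le_const (lt_add_one _)
  have h_bound : Continuous fun p : F × SpaceTime =>
      (1 - (v₁ : ℝ))⁻¹ * |‖p.2.1 - r₂ (p.2.2 - S) p.1‖ - S| := by
    have h_pos : Continuous fun p : F × SpaceTime => r₂ (p.2.2 - S) p.1 :=
      h.continuous.comp (by fun_prop : Continuous fun p : F × SpaceTime => (p.2.2 - S, p.1))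
    exact continuous_const.mul ((continuous_snd.fst.sub h_pos).norm.sub continuous_const).abs
  refine tendsto_iff_dist_tendsto_zero.2 <| squeeze_zero' (.of_forall fun _ => dist_nonneg)
    (h_near.mono fun p hp => ?_) (h_bound.tendsto' p₀ 0 ?_)
  · rw [Real.dist_eq, ← div_eq_inv_mul, le_div_iff₀' hv₁']
    exact mul_abs_sub_le_of_eq_norm_sub_retarded ((hv p.1).mono (Iic_subset_Iic.2 hp))
      (h.timeDelay_eq p.1 p.2) (h.timeDelay_nonneg p₀.1 p₀.2)
  · rw [← show S = ‖p₀.2.1 - r₂ (p₀.2.2 - S) p₀.1‖ from h.timeDelay_eq p₀.1 p₀.2]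
    simp

theorem continuous_retardedTime :
    Continuous fun p : F × SpaceTime => retardedTime r₂ p.1 p.2 :=
  continuous_snd.snd.sub h.continuous_timeDelay

theorem continuous_timeDelay_right : Continuous (timeDelay r₂ r₀) :=
  h.continuous_timeDelay.uncurry_left (f := timeDelay r₂) r₀

theorem continuous_retardedTime_right : Continuous (retardedTime r₂ r₀) :=
  continuous_snd.sub (h.continuous_timeDelay_right r₀)

theorem ae_timeDelay_pos : ∀ᵐ x : SpaceTime, 0 < timeDelay r₂ r₀ x := by
  filter_upwards [ae_prod_fst_ne volume volume (h.differentiable r₀).continuous.measurable]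
    with x hx
  have := norm_pos_iff.2 (sub_ne_zero.2 hx)
  linarith [h.norm_sub_le_two_mul_timeDelay r₀ x]

end IsSubluminalMotion

end TimeDelay

/-! ### The fields `u`, `e`, `z` and their derivatives -/

section Fields

variable {F : Set Space} {r₂ : ℝ → F → Space} {r₀ : F} {x : SpaceTime}

/-- The acceleration of the charge at the retarded time. -/
def retardedAcceleration (r₂ : ℝ → F → Space) (r₀ : F) (x : SpaceTime) : Space :=
  deriv (deriv fun s => r₂ s r₀) (retardedTime r₂ r₀ x)

/-- The derivative of `retardedTime` in the direction `d` where `T > 0`. Like the other derivatives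
below it is given by a closed formula, which also makes sense, and is measurable, where `T = 0`. -/
def retardedTimeDeriv (r₂ : ℝ → F → Space) (r₀ : F) (d x : SpaceTime) : ℝ :=
  zField r₂ r₀ x * (d.2 - inner ℝ (eField r₂ r₀ x) d.1)

/-- The derivative of `eField` in the direction `d` where `T > 0`. -/
def eFieldDeriv (r₂ : ℝ → F → Space) (r₀ : F) (d x : SpaceTime) : Space :=
  uField r₂ r₀ x • (d.1 - retardedTimeDeriv r₂ r₀ d x • retardedVelocity r₂ r₀ x -
    (d.2 - retardedTimeDeriv r₂ r₀ d x) • eField r₂ r₀ x)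

/-- The derivative of `zField` in the direction `d` where `T > 0`. -/
def zFieldDeriv (r₂ : ℝ → F → Space) (r₀ : F) (d x : SpaceTime) : ℝ :=
  zField r₂ r₀ x ^ 2 * (inner ℝ (eFieldDeriv r₂ r₀ d x) (retardedVelocity r₂ r₀ x) +
    retardedTimeDeriv r₂ r₀ d x * inner ℝ (eField r₂ r₀ x) (retardedAcceleration r₂ r₀ x))

/-- The derivative of `u z` in the direction `d` where `T > 0`. -/
def scalarKernelDeriv (r₂ : ℝ → F → Space) (r₀ : F) (d x : SpaceTime) : ℝ :=
  uField r₂ r₀ x * zFieldDeriv r₂ r₀ d x -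
    uField r₂ r₀ x ^ 2 * (d.2 - retardedTimeDeriv r₂ r₀ d x) * zField r₂ r₀ x

/-- The derivative of `u z v` in the direction `d` where `T > 0`. -/
def vectorKernelDeriv (r₂ : ℝ → F → Space) (r₀ : F) (d x : SpaceTime) : Space :=
  scalarKernelDeriv r₂ r₀ d x • retardedVelocity r₂ r₀ x +
    (uField r₂ r₀ x * zField r₂ r₀ x * retardedTimeDeriv r₂ r₀ d x) •
      retardedAcceleration r₂ r₀ x

namespace IsSubluminalMotion

variable (h : IsSubluminalMotion r₂)
include h

theorem sub_retardedPosition_eq_smul_eField :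
    x.1 - r₂ (retardedTime r₂ r₀ x) r₀ = timeDelay r₂ r₀ x • eField r₂ r₀ x := by
  rcases eq_or_ne (timeDelay r₂ r₀ x) 0 with hx | hx
  · rw [hx, zero_smul, ← norm_eq_zero, ← h.timeDelay_eq, hx]
  · rw [eField, one_div, smul_inv_smul₀ hx]

theorem norm_eField_le_one : ‖eField r₂ r₀ x‖ ≤ 1 := by
  rw [eField, norm_smul, ← h.timeDelay_eq, one_div, norm_inv,
    Real.norm_of_nonneg (h.timeDelay_nonneg r₀ x)]
  exact inv_mul_le_one

theorem inner_eField_retardedVelocity_le {v₁ : ℝ≥0} {t₁ : ℝ} (hx : x.2 ≤ t₁)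
    (hv : ∀ t ≤ t₁, ∀ r₀ : F, ‖deriv (fun s => r₂ s r₀) t‖₊ ≤ v₁) :
    inner ℝ (eField r₂ r₀ x) (retardedVelocity r₂ r₀ x) ≤ v₁ :=
  (real_inner_le_norm _ _).trans <| (mul_le_of_le_one_left (norm_nonneg _)
    h.norm_eField_le_one).trans (hv _ ((h.retardedTime_le r₀ x).trans hx) r₀)

theorem one_sub_inner_pos : 0 < 1 - inner ℝ (eField r₂ r₀ x) (retardedVelocity r₂ r₀ x) := by
  obtain ⟨v₁, hv₁, hv⟩ := h.speed_le x.2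
  have : (v₁ : ℝ) < 1 := by exact_mod_cast hv₁
  linarith [h.inner_eField_retardedVelocity_le (r₀ := r₀) le_rfl hv]

theorem zField_mul_one_sub_inner :
    zField r₂ r₀ x * (1 - inner ℝ (eField r₂ r₀ x) (retardedVelocity r₂ r₀ x)) = 1 :=
  one_div_mul_cancel h.one_sub_inner_pos.ne'

theorem exists_norm_zField_le (t₁ : ℝ) :
    ∃ C : ℝ≥0, ∀ (r₀ : F) (x : SpaceTime), x.2 ≤ t₁ → ‖zField r₂ r₀ x‖ ≤ C := by
  obtain ⟨v₁, hv₁, hv⟩ := h.speed_le t₁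
  refine ⟨(1 - v₁)⁻¹, fun r₀ x hx => ?_⟩
  have hv₁' : 0 < 1 - (v₁ : ℝ) := sub_pos.2 (by exact_mod_cast hv₁)
  rw [zField, one_div, norm_inv, Real.norm_of_nonneg h.one_sub_inner_pos.le, NNReal.coe_inv,
    NNReal.coe_sub hv₁.le, NNReal.coe_one]
  gcongr
  exact h.inner_eField_retardedVelocity_le hx hv

theorem hasLineDerivAt_retardedTime (hx : 0 < timeDelay r₂ r₀ x) (d : SpaceTime) :
    HasLineDerivAt ℝ (retardedTime r₂ r₀) (retardedTimeDeriv r₂ r₀ d x) x d := by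
  have h_eq (y : SpaceTime) :
      retardedTime r₂ r₀ y + ‖y.1 - r₂ (retardedTime r₂ r₀ y) r₀‖ = y.2 := by
    rw [← h.timeDelay_eq, retardedTime, sub_add_cancel]
  have h_ne : x.1 ≠ r₂ (retardedTime r₂ r₀ x) r₀ :=
    sub_ne_zero.1 (norm_pos_iff.1 (h.timeDelay_eq r₀ x ▸ hx))
  have h_fderiv := hasFDerivAt_retarded (a := fun t => r₂ t r₀) (e := eField r₂ r₀ x) h_eq
    (h.continuous_retardedTime_right r₀).continuousAt
    (h.differentiable r₀ _).hasDerivAt h_ne (by rw [eField, ← h.timeDelay_eq, one_div])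
    h.one_sub_inner_pos.ne'
  simpa [retardedTimeDeriv, zField, retardedVelocity] using h_fderiv.hasLineDerivAt d

theorem hasLineDerivAt_comp_retardedTime {V : Type*} [NormedAddCommGroup V] [NormedSpace ℝ V]
    {c : ℝ → V} {c' : V} (hx : 0 < timeDelay r₂ r₀ x) (d : SpaceTime)
    (hc : HasDerivAt c c' (retardedTime r₂ r₀ x)) :
    HasLineDerivAt ℝ (fun y => c (retardedTime r₂ r₀ y)) (retardedTimeDeriv r₂ r₀ d x • c') x d :=
  hc.scomp_of_eq 0 (h.hasLineDerivAt_retardedTime hx d) (by simp)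

theorem hasLineDerivAt_retardedVelocity (hx : 0 < timeDelay r₂ r₀ x) (d : SpaceTime) :
    HasLineDerivAt ℝ (retardedVelocity r₂ r₀)
      (retardedTimeDeriv r₂ r₀ d x • retardedAcceleration r₂ r₀ x) x d :=
  h.hasLineDerivAt_comp_retardedTime hx d
    ((h.contDiff r₀).differentiable_deriv_two _).hasDerivAt

theorem hasLineDerivAt_timeDelay (hx : 0 < timeDelay r₂ r₀ x) (d : SpaceTime) :
    HasLineDerivAt ℝ (timeDelay r₂ r₀) (d.2 - retardedTimeDeriv r₂ r₀ d x) x d := by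
  have h_sub : HasLineDerivAt ℝ (fun y : SpaceTime => y.2 - retardedTime r₂ r₀ y)
      (d.2 - retardedTimeDeriv r₂ r₀ d x) x d :=
    HasDerivAt.sub (f := fun s : ℝ => (x + s • d).2)
      ((hasFDerivAt_snd (𝕜 := ℝ) (p := x)).hasLineDerivAt d) (h.hasLineDerivAt_retardedTime hx d)
  simpa only [retardedTime, sub_sub_cancel] using h_sub

theorem hasLineDerivAt_uField (hx : 0 < timeDelay r₂ r₀ x) (d : SpaceTime) :
    HasLineDerivAt ℝ (uField r₂ r₀)
      (-(uField r₂ r₀ x ^ 2 * (d.2 - retardedTimeDeriv r₂ r₀ d x))) x d := by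
  have h_inv := HasDerivAt.fun_inv (h.hasLineDerivAt_timeDelay hx d) (by simpa using hx.ne')
  simp only [zero_smul, add_zero, inv_eq_one_div] at h_inv
  refine h_inv.congr_deriv ?_
  rw [uField]
  ring

theorem hasLineDerivAt_eField (hx : 0 < timeDelay r₂ r₀ x) (d : SpaceTime) :
    HasLineDerivAt ℝ (eField r₂ r₀) (eFieldDeriv r₂ r₀ d x) x d := by
  refine (HasDerivAt.smul (h.hasLineDerivAt_uField hx d) <|
    HasDerivAt.fun_sub ((hasFDerivAt_fst (𝕜 := ℝ) (p := x)).hasLineDerivAt d) <|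
      h.hasLineDerivAt_comp_retardedTime hx d (h.differentiable r₀ _).hasDerivAt).congr_deriv ?_
  have h_uT : uField r₂ r₀ x * timeDelay r₂ r₀ x = 1 := one_div_mul_cancel hx.ne'
  simp only [zero_smul, add_zero, h.sub_retardedPosition_eq_smul_eField, eFieldDeriv,
    ContinuousLinearMap.coe_fst', retardedVelocity]
  match_scalars
  · ring
  · ring
  · linear_combination (-(uField r₂ r₀ x * (d.2 - retardedTimeDeriv r₂ r₀ d x))) * h_uT

theorem hasLineDerivAt_zField (hx : 0 < timeDelay r₂ r₀ x) (d : SpaceTime) :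
    HasLineDerivAt ℝ (zField r₂ r₀) (zFieldDeriv r₂ r₀ d x) x d := by
  have h_inv := HasDerivAt.fun_inv (((h.hasLineDerivAt_eField hx d).inner ℝ
    (h.hasLineDerivAt_retardedVelocity hx d)).const_sub 1)
    (by simpa using h.one_sub_inner_pos.ne')
  simp only [zero_smul, add_zero, inv_eq_one_div] at h_inv
  refine h_inv.congr_deriv ?_
  rw [zFieldDeriv, zField, real_inner_smul_right, div_pow, one_pow]
  ring

theorem hasLineDerivAt_scalarKernel (hx : 0 < timeDelay r₂ r₀ x) (d : SpaceTime) :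
    HasLineDerivAt ℝ (fun y => uField r₂ r₀ y * zField r₂ r₀ y) (scalarKernelDeriv r₂ r₀ d x)
      x d := by
  refine (HasDerivAt.mul (h.hasLineDerivAt_uField hx d)
    (h.hasLineDerivAt_zField hx d)).congr_deriv ?_
  simp only [zero_smul, add_zero, scalarKernelDeriv]
  ring

theorem hasLineDerivAt_vectorKernel (hx : 0 < timeDelay r₂ r₀ x) (d : SpaceTime) :
    HasLineDerivAt ℝ (fun y => (uField r₂ r₀ y * zField r₂ r₀ y) • retardedVelocity r₂ r₀ y)
      (vectorKernelDeriv r₂ r₀ d x) x d := by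
  refine (HasDerivAt.smul (h.hasLineDerivAt_scalarKernel hx d)
    (h.hasLineDerivAt_retardedVelocity hx d)).congr_deriv ?_
  simp only [zero_smul, add_zero, vectorKernelDeriv, smul_smul]
  exact add_comm _ _

end IsSubluminalMotion

end Fields

/-! ### Time derivatives and the kernels of the fields -/

section Kernels

variable {F : Set Space} {r₂ : ℝ → F → Space} {r₀ : F} {x : SpaceTime}

theorem hasDerivAt_time_of_hasLineDerivAt {X V : Type*} [AddCommGroup X] [Module ℝ X]
    [NormedAddCommGroup V] [NormedSpace ℝ V] {f : X × ℝ → V} {f' : V} {x : X × ℝ}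
    (hf : HasLineDerivAt ℝ f f' x (0, 1)) : HasDerivAt (fun s => f (x.1, s)) f' x.2 := by
  rw [HasLineDerivAt, ← sub_self x.2] at hf
  convert hf.comp_sub_const x.2 x.2 using 3 with s
  ext1 <;> simp

theorem retardedTimeDeriv_time : retardedTimeDeriv r₂ r₀ (0, 1) x = zField r₂ r₀ x := by
  simp [retardedTimeDeriv]

theorem retardedTimeDeriv_space (a : Space) :
    retardedTimeDeriv r₂ r₀ (a, 0) x = -(zField r₂ r₀ x * inner ℝ (eField r₂ r₀ x) a) := by
  simp [retardedTimeDeriv]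

theorem eFieldDeriv_time :
    eFieldDeriv r₂ r₀ (0, 1) x =
      (uField r₂ r₀ x * zField r₂ r₀ x) • (eField r₂ r₀ x - retardedVelocity r₂ r₀ x) -
        uField r₂ r₀ x • eField r₂ r₀ x := by
  rw [eFieldDeriv, retardedTimeDeriv_time]
  module

namespace IsSubluminalMotion

variable (h : IsSubluminalMotion r₂)
include h

theorem hasLineDerivAt_uSqE (hx : 0 < timeDelay r₂ r₀ x) (d : SpaceTime) :
    HasLineDerivAt ℝ (uSqE r₂ r₀)
      (uField r₂ r₀ x ^ 2 • eFieldDeriv r₂ r₀ d x -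
        (2 * uField r₂ r₀ x ^ 3 * (d.2 - retardedTimeDeriv r₂ r₀ d x)) • eField r₂ r₀ x) x d := by
  refine (HasDerivAt.smul (HasDerivAt.fun_pow (h.hasLineDerivAt_uField hx d) 2)
    (h.hasLineDerivAt_eField hx d)).congr_deriv ?_
  simp only [zero_smul, add_zero, Nat.cast_ofNat, Nat.add_one_sub_one, pow_one]
  module

theorem hasLineDerivAt_eFieldDeriv_time (hx : 0 < timeDelay r₂ r₀ x) (d : SpaceTime) :
    HasLineDerivAt ℝ (eFieldDeriv r₂ r₀ (0, 1))
      ((uField r₂ r₀ x * zField r₂ r₀ x) • (eFieldDeriv r₂ r₀ d x -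
          retardedTimeDeriv r₂ r₀ d x • retardedAcceleration r₂ r₀ x) +
        scalarKernelDeriv r₂ r₀ d x • (eField r₂ r₀ x - retardedVelocity r₂ r₀ x) -
        (uField r₂ r₀ x • eFieldDeriv r₂ r₀ d x -
          (uField r₂ r₀ x ^ 2 * (d.2 - retardedTimeDeriv r₂ r₀ d x)) • eField r₂ r₀ x)) x d := by
  have h_deriv := HasDerivAt.fun_sub
    (HasDerivAt.fun_smul (h.hasLineDerivAt_scalarKernel hx d)
      (HasDerivAt.fun_sub (h.hasLineDerivAt_eField hx d) (h.hasLineDerivAt_retardedVelocity hx d)))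
    (HasDerivAt.fun_smul (h.hasLineDerivAt_uField hx d) (h.hasLineDerivAt_eField hx d))
  simp only [← eFieldDeriv_time] at h_deriv
  refine h_deriv.congr_deriv ?_
  simp only [zero_smul, add_zero]
  module

theorem hasDerivAt_timeDeriv_eField (hx : 0 < timeDelay r₂ r₀ x) :
    HasDerivAt (fun s => timeDeriv (eField r₂ r₀) (x.1, s))
      ((uField r₂ r₀ x * zField r₂ r₀ x) • (eFieldDeriv r₂ r₀ (0, 1) x -
          zField r₂ r₀ x • retardedAcceleration r₂ r₀ x) +
        scalarKernelDeriv r₂ r₀ (0, 1) x • (eField r₂ r₀ x - retardedVelocity r₂ r₀ x) -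
        (uField r₂ r₀ x • eFieldDeriv r₂ r₀ (0, 1) x -
          (uField r₂ r₀ x ^ 2 * (1 - zField r₂ r₀ x)) • eField r₂ r₀ x)) x.2 := by
  have h_deriv := hasDerivAt_time_of_hasLineDerivAt (h.hasLineDerivAt_eFieldDeriv_time hx (0, 1))
  rw [retardedTimeDeriv_time] at h_deriv
  have h_pos : ∀ᶠ s in 𝓝 x.2, 0 < timeDelay r₂ r₀ (x.1, s) :=
    ((h.continuous_timeDelay_right r₀).comp
      (Continuous.prodMk_right x.1)).continuousAt.eventually_const_lt hx
  exact h_deriv.congr_of_eventuallyEq <| h_pos.mono fun s hs =>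
    (hasDerivAt_time_of_hasLineDerivAt (h.hasLineDerivAt_eField hs (0, 1))).deriv

theorem feynmanField_eq (hx : 0 < timeDelay r₂ r₀ x) :
    feynmanField r₂ r₀ x =
      (scalarKernelDeriv r₂ r₀ (0, 1) x + (uField r₂ r₀ x * zField r₂ r₀ x) ^ 2) •
        (eField r₂ r₀ x - retardedVelocity r₂ r₀ x) -
      (uField r₂ r₀ x * zField r₂ r₀ x ^ 2) • retardedAcceleration r₂ r₀ x := by
  have h_uSqE : timeDeriv (uSqE r₂ r₀) x = _ :=
    (hasDerivAt_time_of_hasLineDerivAt (h.hasLineDerivAt_uSqE hx (0, 1))).deriv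
  have h_eField : timeDeriv (timeDeriv (eField r₂ r₀)) x = _ :=
    (h.hasDerivAt_timeDeriv_eField hx).deriv
  have hu : uField r₂ r₀ x ≠ 0 := one_div_ne_zero hx.ne'
  rw [feynmanField, h_uSqE, h_eField, uSqE, eFieldDeriv_time, retardedTimeDeriv_time]
  match_scalars <;> field

theorem scalarKernelDeriv_time :
    scalarKernelDeriv r₂ r₀ (0, 1) x = zField r₂ r₀ x * ((uField r₂ r₀ x * zField r₂ r₀ x) ^ 2 *
        inner ℝ (eField r₂ r₀ x - retardedVelocity r₂ r₀ x) (retardedVelocity r₂ r₀ x) +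
      uField r₂ r₀ x * zField r₂ r₀ x ^ 2 *
        inner ℝ (eField r₂ r₀ x) (retardedAcceleration r₂ r₀ x)) := by
  simp only [scalarKernelDeriv, zFieldDeriv, eFieldDeriv_time, retardedTimeDeriv_time,
    inner_sub_left, real_inner_smul_left]
  linear_combination
    (uField r₂ r₀ x ^ 2 * zField r₂ r₀ x) * h.zField_mul_one_sub_inner (r₀ := r₀) (x := x)

theorem scalarKernelDeriv_space (a : Space) :
    scalarKernelDeriv r₂ r₀ (a, 0) x =
      -(scalarKernelDeriv r₂ r₀ (0, 1) x * inner ℝ (eField r₂ r₀ x) a +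
        (uField r₂ r₀ x * zField r₂ r₀ x) ^ 2 *
          inner ℝ (eField r₂ r₀ x - retardedVelocity r₂ r₀ x) a) := by
  simp only [scalarKernelDeriv, zFieldDeriv, retardedTimeDeriv_time, eFieldDeriv,
    retardedTimeDeriv_space, inner_sub_left, real_inner_smul_left, inner_zero_left,
    real_inner_comm (retardedVelocity r₂ r₀ x) a]
  linear_combination (uField r₂ r₀ x ^ 2 * zField r₂ r₀ x * inner ℝ (eField r₂ r₀ x) a) *
    h.zField_mul_one_sub_inner (r₀ := r₀) (x := x)

theorem scalarKernelDeriv_single (i : Fin 3) :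
    scalarKernelDeriv r₂ r₀ (EuclideanSpace.single i 1, 0) x =
      -(scalarKernelDeriv r₂ r₀ (0, 1) x * eField r₂ r₀ x i +
        (uField r₂ r₀ x * zField r₂ r₀ x) ^ 2 *
          (eField r₂ r₀ x i - retardedVelocity r₂ r₀ x i)) := by
  rw [h.scalarKernelDeriv_space]
  simp [EuclideanSpace.inner_single_right]

theorem vectorKernelDeriv_single (i j : Fin 3) :
    vectorKernelDeriv r₂ r₀ (EuclideanSpace.single i 1, 0) x j =
      -((scalarKernelDeriv r₂ r₀ (0, 1) x * eField r₂ r₀ x i +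
          (uField r₂ r₀ x * zField r₂ r₀ x) ^ 2 *
            (eField r₂ r₀ x i - retardedVelocity r₂ r₀ x i)) * retardedVelocity r₂ r₀ x j +
        uField r₂ r₀ x * zField r₂ r₀ x ^ 2 * eField r₂ r₀ x i *
          retardedAcceleration r₂ r₀ x j) := by
  rw [vectorKernelDeriv, h.scalarKernelDeriv_single, retardedTimeDeriv_space]
  simp only [PiLp.add_apply, PiLp.smul_apply, smul_eq_mul, EuclideanSpace.inner_single_right,
    conj_trivial, one_mul]
  ring

theorem electric_kernelDeriv_eq_feynmanField (hx : 0 < timeDelay r₂ r₀ x) (i : Fin 3) :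
    -scalarKernelDeriv r₂ r₀ (EuclideanSpace.single i 1, 0) x -
      vectorKernelDeriv r₂ r₀ (0, 1) x i = feynmanField r₂ r₀ x i := by
  rw [h.scalarKernelDeriv_single, vectorKernelDeriv, retardedTimeDeriv_time, h.feynmanField_eq hx]
  simp only [PiLp.add_apply, PiLp.sub_apply, PiLp.smul_apply, smul_eq_mul]
  ring

theorem curl_vectorKernelDeriv (hx : 0 < timeDelay r₂ r₀ x) (i : Fin 3) :
    vectorKernelDeriv r₂ r₀ (EuclideanSpace.single (i + 1) 1, 0) x (i + 2) -
      vectorKernelDeriv r₂ r₀ (EuclideanSpace.single (i + 2) 1, 0) x (i + 1) =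
    cross (eField r₂ r₀ x) (feynmanField r₂ r₀ x) i := by
  have cross_coord (a b : Space) : cross a b i = a (i + 1) * b (i + 2) - a (i + 2) * b (i + 1) := by
    fin_cases i <;> simp [cross, cross_apply]
  rw [cross_coord, h.vectorKernelDeriv_single, h.vectorKernelDeriv_single, h.feynmanField_eq hx]
  simp only [PiLp.sub_apply, PiLp.smul_apply, smul_eq_mul]
  ring

theorem divergence_vectorKernelDeriv_add :
    vectorKernelDeriv r₂ r₀ (EuclideanSpace.single 0 1, 0) x 0 +
      vectorKernelDeriv r₂ r₀ (EuclideanSpace.single 1 1, 0) x 1 +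
      vectorKernelDeriv r₂ r₀ (EuclideanSpace.single 2 1, 0) x 2 +
      scalarKernelDeriv r₂ r₀ (0, 1) x = 0 := by
  have h_time : (1 - inner ℝ (eField r₂ r₀ x) (retardedVelocity r₂ r₀ x)) *
      scalarKernelDeriv r₂ r₀ (0, 1) x = (uField r₂ r₀ x * zField r₂ r₀ x) ^ 2 *
        inner ℝ (eField r₂ r₀ x - retardedVelocity r₂ r₀ x) (retardedVelocity r₂ r₀ x) +
      uField r₂ r₀ x * zField r₂ r₀ x ^ 2 *
        inner ℝ (eField r₂ r₀ x) (retardedAcceleration r₂ r₀ x) := by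
    rw [h.scalarKernelDeriv_time, ← mul_assoc, mul_comm (1 - _), h.zField_mul_one_sub_inner,
      one_mul]
  simp only [PiLp.inner_apply, Fin.sum_univ_three, RCLike.inner_apply, conj_trivial,
    PiLp.sub_apply] at h_time
  simp only [h.vectorKernelDeriv_single]
  linear_combination h_time

end IsSubluminalMotion

end Kernels

/-! ### Local integrability of the kernels -/

section LocalIntegrability

variable {F : Set Space} {r₂ : ℝ → F → Space}

theorem UniformlyLocallyIntegrable.mono {ι X V W : Type*} [TopologicalSpace X] [T2Space X]
    [MeasureSpace X] [OpensMeasurableSpace X] [NormedAddCommGroup V] [NormedAddCommGroup W]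
    {f : ι → X → V} {g : ι → X → W} (hf : UniformlyLocallyIntegrable f)
    (hg : ∀ K : Set X, IsCompact K → ∃ C : ℝ≥0, ∀ i, ∀ x ∈ K, ‖g i x‖ ≤ C * ‖f i x‖) :
    UniformlyLocallyIntegrable g := by
  intro K hK
  obtain ⟨C, hC⟩ := hf K hK
  obtain ⟨D, hD⟩ := hg K hK
  refine ⟨D * C, fun i => ?_⟩
  calc ∫⁻ x in K, ‖g i x‖ₑ ≤ ∫⁻ x in K, D * ‖f i x‖ₑ :=
        setLIntegral_mono' hK.measurableSet fun x hx => ENNReal.coe_le_coe.2 (hD i x hx)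
    _ = D * ∫⁻ x in K, ‖f i x‖ₑ := lintegral_const_mul' _ _ ENNReal.coe_ne_top
    _ ≤ (D * C : ℝ≥0) := by
        rw [ENNReal.coe_mul]
        gcongr
        exact hC i

theorem isBigO_inner {α V : Type*} [NormedAddCommGroup V] [InnerProductSpace ℝ V] {l : Filter α}
    {f g : α → V} {f' g' : α → ℝ} (hf : f =O[l] f') (hg : g =O[l] g') :
    (fun y => inner ℝ (f y) (g y)) =O[l] fun y => f' y * g' y :=
  (IsBigO.of_bound 1 <| .of_forall fun y => by
    simpa using norm_inner_le_norm (𝕜 := ℝ) (f y) (g y)).trans (hf.norm_left.mul hg.norm_left)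

namespace IsSubluminalMotion

variable (h : IsSubluminalMotion r₂)
include h

theorem measurable_uField : Measurable (Function.uncurry (uField r₂)) :=
  h.continuous_timeDelay.measurable.const_div 1

theorem measurable_eField : Measurable (Function.uncurry (eField r₂)) :=
  h.measurable_uField.smul (continuous_snd.fst.sub
    (h.continuous.comp (h.continuous_retardedTime.prodMk continuous_fst))).measurable

theorem measurable_retardedVelocity : Measurable (Function.uncurry (retardedVelocity r₂)) :=
  (measurable_deriv_with_param (f := fun r₀ t => r₂ t r₀) (h.continuous.comp continuous_swap)).comp
    (measurable_fst.prodMk h.continuous_retardedTime.measurable)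

theorem measurable_zField : Measurable (Function.uncurry (zField r₂)) :=
  ((h.measurable_eField.inner h.measurable_retardedVelocity).const_sub 1).const_div 1

theorem continuous_retardedVelocity_right (r₀ : F) : Continuous (retardedVelocity r₂ r₀) :=
  ((h.contDiff r₀).continuous_deriv one_le_two).comp (h.continuous_retardedTime_right r₀)

theorem continuous_retardedAcceleration_right (r₀ : F) : Continuous (retardedAcceleration r₂ r₀) :=
  (((contDiff_succ_iff_deriv (n := 1)).1 (h.contDiff r₀)).2.2.continuous_deriv_one).comp
    (h.continuous_retardedTime_right r₀)

theorem measurable_retardedTimeDeriv (r₀ : F) (d : SpaceTime) :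
    Measurable (retardedTimeDeriv r₂ r₀ d) :=
  h.measurable_zField.of_uncurry_left.mul
    ((h.measurable_eField.of_uncurry_left.inner measurable_const).const_sub d.2)

theorem measurable_eFieldDeriv (r₀ : F) (d : SpaceTime) : Measurable (eFieldDeriv r₂ r₀ d) :=
  have hτ := h.measurable_retardedTimeDeriv r₀ d
  h.measurable_uField.of_uncurry_left.smul
    (((hτ.smul (h.continuous_retardedVelocity_right r₀).measurable).const_sub d.1).sub
      ((hτ.const_sub d.2).smul h.measurable_eField.of_uncurry_left))

theorem measurable_zFieldDeriv (r₀ : F) (d : SpaceTime) : Measurable (zFieldDeriv r₂ r₀ d) :=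
  (h.measurable_zField.of_uncurry_left.pow_const 2).mul
    (((h.measurable_eFieldDeriv r₀ d).inner
      (h.continuous_retardedVelocity_right r₀).measurable).add
    ((h.measurable_retardedTimeDeriv r₀ d).mul
      (h.measurable_eField.of_uncurry_left.inner
        (h.continuous_retardedAcceleration_right r₀).measurable)))

theorem measurable_scalarKernelDeriv (r₀ : F) (d : SpaceTime) :
    Measurable (scalarKernelDeriv r₂ r₀ d) :=
  have hu := h.measurable_uField.of_uncurry_left (x := r₀)
  (hu.mul (h.measurable_zFieldDeriv r₀ d)).sub
    (((hu.pow_const 2).mul ((h.measurable_retardedTimeDeriv r₀ d).const_sub d.2)).mul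
      h.measurable_zField.of_uncurry_left)

theorem measurable_vectorKernelDeriv (r₀ : F) (d : SpaceTime) :
    Measurable (vectorKernelDeriv r₂ r₀ d) :=
  ((h.measurable_scalarKernelDeriv r₀ d).smul
    (h.continuous_retardedVelocity_right r₀).measurable).add
    (((h.measurable_uField.of_uncurry_left.mul h.measurable_zField.of_uncurry_left).mul
      (h.measurable_retardedTimeDeriv r₀ d)).smul
      (h.continuous_retardedAcceleration_right r₀).measurable)

theorem enorm_uField_pow_le {r₀ : F} {x : SpaceTime} (hx : x.1 ≠ r₂ x.2 r₀) (k : ℕ) :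
    ‖uField r₂ r₀ x ^ k‖ₑ ≤ 2 ^ k * ‖‖x.1 - r₂ x.2 r₀‖⁻¹ ^ k‖ₑ := by
  have h_pos : 0 < ‖x.1 - r₂ x.2 r₀‖ := norm_pos_iff.2 (sub_ne_zero.2 hx)
  have h_le : ‖uField r₂ r₀ x‖ ≤ ‖2 * ‖x.1 - r₂ x.2 r₀‖⁻¹‖ := by
    have hT : 0 < timeDelay r₂ r₀ x := by linarith [h.norm_sub_le_two_mul_timeDelay r₀ x]
    rw [uField, Real.norm_of_nonneg (by positivity), Real.norm_of_nonneg (by positivity),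
      ← div_eq_mul_inv, div_le_div_iff₀ hT h_pos, one_mul]
    exact h.norm_sub_le_two_mul_timeDelay r₀ x
  calc ‖uField r₂ r₀ x ^ k‖ₑ ≤ ‖(2 * ‖x.1 - r₂ x.2 r₀‖⁻¹) ^ k‖ₑ := by
        rw [enorm_pow, enorm_pow]
        gcongr
        exact enorm_le_iff_norm_le.2 h_le
    _ = 2 ^ k * ‖‖x.1 - r₂ x.2 r₀‖⁻¹ ^ k‖ₑ := by
        rw [mul_pow, enorm_mul, enorm_pow, Real.enorm_of_nonneg zero_le_two, ENNReal.ofReal_ofNat]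

theorem uniformlyLocallyIntegrable_uField_pow {k : ℕ} (hk : k < 3) :
    UniformlyLocallyIntegrable fun (r₀ : F) (x : SpaceTime) => uField r₂ r₀ x ^ k := by
  intro K hK
  obtain ⟨ρ, hρ⟩ := hK.isBounded.subset_closedBall 0
  set C : ℝ≥0∞ := ((∫⁻ w in Metric.ball (0 : Space) 1, ‖‖w‖⁻¹ ^ k‖ₑ) +
    volume (Metric.closedBall (0 : Space) ρ)) * volume (Metric.closedBall (0 : ℝ) ρ)
  have h_ball : ∫⁻ w in Metric.ball (0 : Space) 1, ‖‖w‖⁻¹ ^ k‖ₑ ≠ ⊤ :=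
    (integrableOn_ball_inv_norm_pow volume (hk.trans_eq finrank_euclideanSpace_fin.symm) 1).2.ne
  have hC : 2 ^ k * C ≠ ⊤ := ENNReal.mul_ne_top (by finiteness) <| ENNReal.mul_ne_top
    (ENNReal.add_ne_top.2 ⟨h_ball, measure_closedBall_lt_top.ne⟩) measure_closedBall_lt_top.ne
  refine ⟨(2 ^ k * C).toNNReal, fun r₀ => ?_⟩
  have h_meas : Measurable fun t => r₂ t r₀ := (h.differentiable r₀).continuous.measurable
  calc ∫⁻ x in K, ‖uField r₂ r₀ x ^ k‖ₑ
      ≤ ∫⁻ x in K, 2 ^ k * ‖‖x.1 - r₂ x.2 r₀‖⁻¹ ^ k‖ₑ :=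
        lintegral_mono_ae <| ae_restrict_of_ae <|
          (ae_prod_fst_ne volume volume h_meas).mono fun x hx => h.enorm_uField_pow_le hx k
    _ ≤ ∫⁻ x in Metric.closedBall 0 ρ ×ˢ Metric.closedBall 0 ρ,
          2 ^ k * ‖‖x.1 - r₂ x.2 r₀‖⁻¹ ^ k‖ₑ :=
        lintegral_mono_set (hρ.trans (closedBall_prod_same _ _ _).ge)
    _ = 2 ^ k * ∫⁻ x in Metric.closedBall 0 ρ ×ˢ Metric.closedBall 0 ρ,
          ‖‖x.1 - r₂ x.2 r₀‖⁻¹ ^ k‖ₑ := lintegral_const_mul' _ _ (by finiteness)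
    _ ≤ 2 ^ k * C := by
        gcongr
        exact setLIntegral_prod_inv_norm_sub_pow_le volume volume k h_meas _ _
    _ = (2 ^ k * C).toNNReal := (ENNReal.coe_toNNReal hC).symm

theorem uniformlyLocallyIntegrable_scalarKernel :
    UniformlyLocallyIntegrable fun (r₀ : F) (x : SpaceTime) =>
      uField r₂ r₀ x * zField r₂ r₀ x := by
  refine (h.uniformlyLocallyIntegrable_uField_pow (k := 1) (by norm_num)).mono fun K hK => ?_
  obtain ⟨t₁, ht₁⟩ := hK.exists_bound_of_continuousOn continuous_snd.continuousOn
  obtain ⟨C, hC⟩ := h.exists_norm_zField_le t₁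
  refine ⟨C, fun r₀ x hx => ?_⟩
  rw [pow_one, norm_mul, mul_comm]
  gcongr
  exact hC r₀ x ((le_abs_self _).trans (ht₁ x hx))

theorem uniformlyLocallyIntegrable_vectorKernel (i : Fin 3) :
    UniformlyLocallyIntegrable fun (r₀ : F) (x : SpaceTime) =>
      ((uField r₂ r₀ x * zField r₂ r₀ x) • retardedVelocity r₂ r₀ x) i := by
  refine h.uniformlyLocallyIntegrable_scalarKernel.mono fun K hK => ?_
  obtain ⟨t₁, ht₁⟩ := hK.exists_bound_of_continuousOn continuous_snd.continuousOn
  obtain ⟨v₁, -, hv⟩ := h.speed_le t₁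
  refine ⟨v₁, fun r₀ x hx => ?_⟩
  rw [PiLp.smul_apply, norm_smul, mul_comm]
  gcongr
  exact (PiLp.norm_apply_le _ i).trans
    (hv _ ((h.retardedTime_le r₀ x).trans ((le_abs_self _).trans (ht₁ x hx))) r₀)

section Asymptotics

variable (r₀ : F) (d x : SpaceTime)

theorem isBigO_eField : eField r₂ r₀ =O[𝓝 x] fun _ => (1 : ℝ) :=
  .of_bound 1 <| .of_forall fun _ => by simpa using h.norm_eField_le_one

theorem isBigO_zField : zField r₂ r₀ =O[𝓝 x] fun _ => (1 : ℝ) := by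
  obtain ⟨C, hC⟩ := h.exists_norm_zField_le (x.2 + 1)
  refine .of_bound C ?_
  filter_upwards [(continuous_snd.tendsto x).eventually_le_const (lt_add_one _)] with y hy
  simpa using hC r₀ y hy

theorem isBigO_retardedVelocity : retardedVelocity r₂ r₀ =O[𝓝 x] fun _ => (1 : ℝ) :=
  ((h.continuous_retardedVelocity_right r₀).tendsto x).isBigO_one ℝ

theorem isBigO_retardedAcceleration : retardedAcceleration r₂ r₀ =O[𝓝 x] fun _ => (1 : ℝ) :=
  ((h.continuous_retardedAcceleration_right r₀).tendsto x).isBigO_one ℝ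

theorem isBigO_uField : uField r₂ r₀ =O[𝓝 x] fun y => uField r₂ r₀ y ^ 2 := by
  have h_eq (y : SpaceTime) : timeDelay r₂ r₀ y * uField r₂ r₀ y ^ 2 = uField r₂ r₀ y := by
    rcases eq_or_ne (timeDelay r₂ r₀ y) 0 with hy | hy
    · simp [uField, hy]
    · rw [uField]
      field_simp
  exact ((((h.continuous_timeDelay_right r₀).tendsto x).isBigO_one ℝ).mul
    (isBigO_refl (fun y => uField r₂ r₀ y ^ 2) (𝓝 x))).congr h_eq fun _ => one_mul _

theorem isBigO_retardedTimeDeriv :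
    retardedTimeDeriv r₂ r₀ d =O[𝓝 x] fun _ => (1 : ℝ) := by
  have h_inner := isBigO_inner (h.isBigO_eField r₀ x)
    (isBigO_const_const d.1 (one_ne_zero (α := ℝ)) (𝓝 x))
  simp only [mul_one] at h_inner
  exact ((h.isBigO_zField r₀ x).mul
    ((isBigO_const_const d.2 one_ne_zero _).sub h_inner)).congr_right fun _ => mul_one 1

theorem isBigO_eFieldDeriv : eFieldDeriv r₂ r₀ d =O[𝓝 x] uField r₂ r₀ := by
  have hτ := h.isBigO_retardedTimeDeriv r₀ d x
  have h_velocity := hτ.smul (h.isBigO_retardedVelocity r₀ x)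
  have h_delay :=
    ((isBigO_const_const d.2 one_ne_zero _).sub hτ).smul (h.isBigO_eField r₀ x)
  simp only [smul_eq_mul, mul_one] at h_velocity h_delay
  exact ((isBigO_refl (uField r₂ r₀) (𝓝 x)).smul
    (((isBigO_const_const d.1 one_ne_zero _).sub h_velocity).sub h_delay)).congr_right
      fun _ => mul_one _

theorem isBigO_uField_mul_zFieldDeriv :
    (fun y => uField r₂ r₀ y * zFieldDeriv r₂ r₀ d y) =O[𝓝 x] fun y => uField r₂ r₀ y ^ 2 := by
  have hu := isBigO_refl (uField r₂ r₀) (𝓝 x)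
  have h_eDeriv := hu.mul <|
    isBigO_inner (h.isBigO_eFieldDeriv r₀ d x) (h.isBigO_retardedVelocity r₀ x)
  have h_accel := hu.mul <| (h.isBigO_retardedTimeDeriv r₀ d x).mul <|
    isBigO_inner (h.isBigO_eField r₀ x) (h.isBigO_retardedAcceleration r₀ x)
  simp only [mul_one] at h_eDeriv h_accel
  simp only [← pow_two] at h_eDeriv
  refine (((h.isBigO_zField r₀ x).pow 2).mul
    (h_eDeriv.add (h_accel.trans (h.isBigO_uField r₀ x)))).congr (fun y => ?_) fun y => ?_
  · rw [zFieldDeriv]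
    ring
  · ring

theorem isBigO_scalarKernelDeriv :
    scalarKernelDeriv r₂ r₀ d =O[𝓝 x] fun y => uField r₂ r₀ y ^ 2 := by
  have h_one := isBigO_const_const (l := 𝓝 x) d.2 (one_ne_zero (α := ℝ))
  have h_delay := ((isBigO_refl (fun y => uField r₂ r₀ y ^ 2) (𝓝 x)).mul
    (h_one.sub (h.isBigO_retardedTimeDeriv r₀ d x))).mul (h.isBigO_zField r₀ x)
  simp only [mul_one] at h_delay
  exact (h.isBigO_uField_mul_zFieldDeriv r₀ d x).sub h_delay

theorem isBigO_vectorKernelDeriv :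
    vectorKernelDeriv r₂ r₀ d =O[𝓝 x] fun y => uField r₂ r₀ y ^ 2 := by
  have h_velocity := (h.isBigO_scalarKernelDeriv r₀ d x).smul (h.isBigO_retardedVelocity r₀ x)
  have h_accel := (((h.isBigO_uField r₀ x).mul (h.isBigO_zField r₀ x)).mul
    (h.isBigO_retardedTimeDeriv r₀ d x)).smul (h.isBigO_retardedAcceleration r₀ x)
  simp only [smul_eq_mul, mul_one] at h_velocity h_accel
  exact h_velocity.add h_accel

theorem isBigO_scalarKernel :
    (fun y => uField r₂ r₀ y * zField r₂ r₀ y) =O[𝓝 x] uField r₂ r₀ :=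
  ((isBigO_refl (uField r₂ r₀) _).mul (h.isBigO_zField r₀ x)).congr_right fun _ => mul_one _

theorem isBigO_vectorKernel :
    (fun y => (uField r₂ r₀ y * zField r₂ r₀ y) • retardedVelocity r₂ r₀ y) =O[𝓝 x]
      uField r₂ r₀ :=
  ((h.isBigO_scalarKernel r₀ x).smul (h.isBigO_retardedVelocity r₀ x)).congr_right
    fun _ => mul_one _

theorem isBigO_mul_timeDelayDeriv_mul_inv {f : SpaceTime → ℝ} (hf : f =O[𝓝 x] uField r₂ r₀) :
    (fun y => f y * (d.2 - retardedTimeDeriv r₂ r₀ d y) * (timeDelay r₂ r₀ y)⁻¹) =O[𝓝 x]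
      fun y => uField r₂ r₀ y ^ 2 := by
  refine ((hf.mul ((isBigO_const_const d.2 one_ne_zero _).sub
    (h.isBigO_retardedTimeDeriv r₀ d x))).mul (isBigO_refl (uField r₂ r₀) _)).congr
      (fun y => ?_) fun y => ?_
  · rw [uField, one_div]
  · ring

end Asymptotics

theorem locallyIntegrable_of_isBigO {r₀ : F} {f : SpaceTime → ℝ}
    (hm : AEStronglyMeasurable f) (hf : ∀ x, f =O[𝓝 x] fun y => uField r₂ r₀ y ^ 2) :
    LocallyIntegrable f := fun x =>
  (hf x).integrableAtFilter hm.stronglyMeasurableAtFilter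
    ((h.uniformlyLocallyIntegrable_uField_pow (k := 2) (by norm_num)).locallyIntegrable
      (h.measurable_uField.of_uncurry_left.pow_const 2).aestronglyMeasurable x)

end IsSubluminalMotion

end LocalIntegrability

/-! ### The potentials and the fields -/

section Potentials

variable {F : Set Space} {r₂ : ℝ → F → Space} {q : SignedMeasure F} {φ : ScalarDistribution}
  {A : VectorDistribution}

namespace IsSubluminalMotion

variable (h : IsSubluminalMotion r₂)
include h

theorem exists_isScalarPotential (q : SignedMeasure F) : ∃ φ, IsScalarPotential r₂ q φ :=
  exists_isChargeIntegral q h.uniformlyLocallyIntegrable_scalarKernel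
    (h.measurable_uField.mul h.measurable_zField)

theorem measurable_vectorKernel (i : Fin 3) :
    Measurable (Function.uncurry fun (r₀ : F) (x : SpaceTime) =>
      ((uField r₂ r₀ x * zField r₂ r₀ x) • retardedVelocity r₂ r₀ x) i) :=
  (EuclideanSpace.proj (𝕜 := ℝ) i).continuous.measurable.comp
    ((h.measurable_uField.mul h.measurable_zField).smul h.measurable_retardedVelocity)

theorem exists_isVectorPotential (q : SignedMeasure F) : ∃ A, IsVectorPotential r₂ q A :=
  Classical.skolem.1 fun i => exists_isChargeIntegral q
    (h.uniformlyLocallyIntegrable_vectorKernel i) (h.measurable_vectorKernel i)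

theorem isChargeIntegral_lineDerivOp {f f' : F → SpaceTime → ℝ} {H : ScalarDistribution}
    {d : SpaceTime} (hf : IsChargeIntegral q f H) (hm' : ∀ r₀, Measurable (f' r₀))
    (hfd : ∀ r₀ x, 0 < timeDelay r₂ r₀ x → HasLineDerivAt ℝ (f r₀) (f' r₀ x) x d)
    (hu : ∀ r₀ x, f r₀ =O[𝓝 x] uField r₂ r₀)
    (hu' : ∀ r₀ x, f' r₀ =O[𝓝 x] fun y => uField r₂ r₀ y ^ 2) :
    IsChargeIntegral q f' (∂_{d} H) := by
  have : (volume : Measure SpaceTime).IsAddHaarMeasure := by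
    rw [Measure.volume_eq_prod]
    infer_instance
  have hf' (r₀ : F) : LocallyIntegrable (f' r₀) := 
    h.locallyIntegrable_of_isBigO (hm' r₀).aestronglyMeasurable (hu' r₀)
  have hfT (r₀ : F) : LocallyIntegrable fun x =>
      f r₀ x * (d.2 - retardedTimeDeriv r₂ r₀ d x) * (timeDelay r₂ r₀ x)⁻¹ :=
    h.locallyIntegrable_of_isBigO
      (((hf.1 r₀).aestronglyMeasurable.mul
        ((h.measurable_retardedTimeDeriv r₀ d).const_sub d.2).aestronglyMeasurable).mul
        (h.continuous_timeDelay_right r₀).measurable.inv.aestronglyMeasurable)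
      fun x => h.isBigO_mul_timeDelayDeriv_mul_inv r₀ d x (hu r₀ x)
  exact hf.lineDerivOp hf' fun r₀ g => integral_testFunction_lineDeriv_mul
    (h.continuous_timeDelay_right r₀) (h.ae_timeDelay_pos r₀)
    (fun x hx => h.hasLineDerivAt_timeDelay hx d) (hfd r₀) (hf.1 r₀) (hf' r₀) (hfT r₀) g

theorem isChargeIntegral_lineDerivOp_scalarPotential (hφ : IsScalarPotential r₂ q φ)
    (d : SpaceTime) :
    IsChargeIntegral q (fun r₀ => scalarKernelDeriv r₂ r₀ d) (∂_{d} φ) :=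
  h.isChargeIntegral_lineDerivOp hφ (fun r₀ => h.measurable_scalarKernelDeriv r₀ d)
    (fun _ _ hx => h.hasLineDerivAt_scalarKernel hx d)
    (fun r₀ x => h.isBigO_scalarKernel r₀ x)
    fun r₀ x => h.isBigO_scalarKernelDeriv r₀ d x

theorem isChargeIntegral_lineDerivOp_vectorPotential (hA : IsVectorPotential r₂ q A)
    (d : SpaceTime) (i : Fin 3) :
    IsChargeIntegral q (fun r₀ x => vectorKernelDeriv r₂ r₀ d x i) (∂_{d} (A i)) := by
  have isBigO_coord (V : SpaceTime → Space) (x : SpaceTime) : (fun y => V y i) =O[𝓝 x] V :=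
    isBigO_of_le _ fun y => PiLp.norm_apply_le (V y) i
  exact h.isChargeIntegral_lineDerivOp (hA i)
    (fun r₀ => (EuclideanSpace.proj (𝕜 := ℝ) i).continuous.measurable.comp
      (h.measurable_vectorKernelDeriv r₀ d))
    (fun _ _ hx => (EuclideanSpace.proj (𝕜 := ℝ) i).hasFDerivAt.comp_hasDerivAt 0
      (h.hasLineDerivAt_vectorKernel hx d))
    (fun r₀ x => (isBigO_coord _ x).trans (h.isBigO_vectorKernel r₀ x))
    fun r₀ x => (isBigO_coord _ x).trans (h.isBigO_vectorKernelDeriv r₀ d x)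

theorem lorenz_gauge (hφ : IsScalarPotential r₂ q φ) (hA : IsVectorPotential r₂ q A) :
    divergence A + dTime φ = 0 := by
  have dA (i : Fin 3) := h.isChargeIntegral_lineDerivOp_vectorPotential hA
    (EuclideanSpace.single i 1, 0) i
  have dφ := h.isChargeIntegral_lineDerivOp_scalarPotential hφ (0, 1)
  exact ((((dA 0).add (dA 1)).add (dA 2)).add dφ).eq_zero fun r₀ =>
    .of_forall fun x => h.divergence_vectorKernelDeriv_add

theorem isChargeIntegralVec_neg_grad_sub_dTimeVec (hφ : IsScalarPotential r₂ q φ)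
    (hA : IsVectorPotential r₂ q A) :
    IsChargeIntegralVec q (fun r₀ x => feynmanField r₂ r₀ x) (-grad φ - dTimeVec A) := fun i =>
  ((h.isChargeIntegral_lineDerivOp_scalarPotential hφ (EuclideanSpace.single i 1, 0)).neg.sub
    (h.isChargeIntegral_lineDerivOp_vectorPotential hA (0, 1) i)).congr_ae fun r₀ =>
      (h.ae_timeDelay_pos r₀).mono fun _ hx => h.electric_kernelDeriv_eq_feynmanField hx i

theorem isChargeIntegralVec_curl (hA : IsVectorPotential r₂ q A) :
    IsChargeIntegralVec q (fun r₀ x => cross (eField r₂ r₀ x) (feynmanField r₂ r₀ x))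
      (curl A) := by
  intro i
  have curl_coord : curl A i = dSpace (i + 1) (A (i + 2)) - dSpace (i + 2) (A (i + 1)) := by
    fin_cases i <;> rfl
  rw [curl_coord]
  exact ((h.isChargeIntegral_lineDerivOp_vectorPotential hA
    (EuclideanSpace.single (i + 1) 1, 0) (i + 2)).sub
    (h.isChargeIntegral_lineDerivOp_vectorPotential hA
      (EuclideanSpace.single (i + 2) 1, 0) (i + 1))).congr_ae fun r₀ =>
        (h.ae_timeDelay_pos r₀).mono fun _ hx => h.curl_vectorKernelDeriv hx i

end IsSubluminalMotion

end Potentials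

end MatterFlow

end

theorem mainTheorem1_general (F : Set Space) (r₂ : ℝ → F → Space) (h : IsSubluminalMotion r₂)
    (q : SignedMeasure F) :
    (∀ (r₀ : F) (x : SpaceTime), 0 < timeDelay r₂ r₀ x →
      DifferentiableAt ℝ (fun s => uSqE r₂ r₀ (x.1, s)) x.2 ∧
      DifferentiableAt ℝ (fun s => eField r₂ r₀ (x.1, s)) x.2 ∧
      DifferentiableAt ℝ (fun s => timeDeriv (eField r₂ r₀) (x.1, s)) x.2) ∧
    ∃ (φ : ScalarDistribution) (A : VectorDistribution),
      IsScalarPotential r₂ q φ ∧ IsVectorPotential r₂ q A ∧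
      ∀ (S : ScalarDistribution) (J E B : VectorDistribution),
        S = -box φ → J = -boxVec A → E = -grad φ - dTimeVec A → B = curl A →
        divergence E = S ∧
        curl E = -dTimeVec B ∧
        divergence B = 0 ∧
        curl B = dTimeVec E + J ∧
        IsChargeIntegralVec q (fun r₀ x => feynmanField r₂ r₀ x) E ∧
        IsChargeIntegralVec q (fun r₀ x => cross (eField r₂ r₀ x) (feynmanField r₂ r₀ x)) B ∧
        divergence J + dTime S = 0 := by
  refine ⟨fun r₀ x hx => ⟨?_, ?_, ?_⟩, ?_⟩
  · exact (hasDerivAt_time_of_hasLineDerivAt (h.hasLineDerivAt_uSqE hx _)).differentiableAt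
  · exact (hasDerivAt_time_of_hasLineDerivAt (h.hasLineDerivAt_eField hx _)).differentiableAt
  · exact (h.hasDerivAt_timeDeriv_eField hx).differentiableAt
  obtain ⟨φ, hφ⟩ := h.exists_isScalarPotential q
  obtain ⟨A, hA⟩ := h.exists_isVectorPotential q
  have lorenz := h.lorenz_gauge hφ hA
  refine ⟨φ, A, hφ, hA, ?_⟩
  rintro S J E B rfl rfl rfl rfl
  exact ⟨divergence_neg_grad_sub_dTimeVec lorenz, curl_neg_grad_sub_dTimeVec φ A,
    divergence_curl A, curl_curl_of_lorenz lorenz,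
    h.isChargeIntegralVec_neg_grad_sub_dTimeVec hφ hA, h.isChargeIntegralVec_curl hA,
    continuity_of_lorenz lorenz⟩

theorem mainTheorem1 (F : Set Space) (t₀ : ℝ) (r₂ : ℝ → F → Space)
    (hflow : IsFlowOfMatter F t₀ r₂) (q : SignedMeasure F) :
    -- the time derivatives in the integrands exist in the classical sense where `T > 0`
    (∀ (r₀ : F) (x : SpaceTime), 0 < timeDelay r₂ r₀ x →
      DifferentiableAt ℝ (fun s => uSqE r₂ r₀ (x.1, s)) x.2 ∧
      DifferentiableAt ℝ (fun s => eField r₂ r₀ (x.1, s)) x.2 ∧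
      DifferentiableAt ℝ (fun s => timeDeriv (eField r₂ r₀) (x.1, s)) x.2) ∧
    -- the potentials are well-defined generalized functions
    ∃ (φ : ScalarDistribution) (A : VectorDistribution),
      IsScalarPotential r₂ q φ ∧ IsVectorPotential r₂ q A ∧
      ∀ (S : ScalarDistribution) (J E B : VectorDistribution),
        S = -box φ → J = -boxVec A → E = -grad φ - dTimeVec A → B = curl A →
        -- Maxwell's equations
        divergence E = S ∧
        curl E = -dTimeVec B ∧
        divergence B = 0 ∧
        curl B = dTimeVec E + J ∧
        -- integral representations of the fields
        IsChargeIntegralVec q (fun r₀ x => feynmanField r₂ r₀ x) E ∧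
        IsChargeIntegralVec q (fun r₀ x => cross (eField r₂ r₀ x) (feynmanField r₂ r₀ x)) B ∧
        -- equation of continuity
        divergence J + dTime S = 0 :=
  mainTheorem1_general F r₂ hflow.isSubluminalMotion q
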